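/- **Model.** The ultra-wide word RAM (UW-RAM) with word size $w$ has a memory of $2^w$ words of $w$ bits, word registers, and wide registers of $w^2$ bits; a wide word $W$ consists of $w$ blocks $W_0,\dots,W_{w-1}$ of $w$ bits. A program is a finite list of instructions. Each of the following takes one unit of time: immediate operands, moves, indirect load and store, jumps (unconditional, on zero, on comparison), reporting a word, halting; addition and subtraction (modulo $2^w$, respectively $2^{w^2}$), left and right shifts and bitwise AND, OR, NOT on words and on wide words; the test whether a wide word is zero; compress ($X[j]\leftarrow W_j[0]$ for $j<w$) and spread ($X_j[0]\leftarrow W[j]$ for $j<w$); and reads and writes between memory and one block ($W_j\leftrightarrow \mathrm{MEM}[\mathrm{base}+j]$), all blocks at consecutive addresses, or all blocks at addresses given by the contents of a wide word (concurrent reads are allowed, concurrent writes to one address are not). **Input and output.** Let $\sigma\ge 2$ and $1\le m\le n$, and let $w\ge \log_2(n+m+\sigma)+4$. Let $T$ be a text of length $n$ and $P$ a pattern of length $m$ over $\{0,\dots,\sigma-1\}$. They are stored in memory, packed with $\lceil\log_2\sigma\rceil$ bits per character; the rest of the memory is zero, and $n,m,\sigma,\lceil\log_2\sigma\rceil,w$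 and the address of $P$ are given in registers. The program has to report the (1-based) starting positions of all occurrences of $P$ in $T$, in increasing order. **Boyer–Moore–Horspool (BMH).** A window of length $m$ starts at $T[1..m]$. After a window at $T[i..i+m-1]$ has been compared with $P$, it is moved to the right by $m-j$, where $j$ is the last position in $P[1..m-1]$ of the character $T[i+m-1]$, or by $m$ if this character does not occur in $P[1..m-1]$; the search ends when the window leaves $T$. A program is an implementation of BMH if a fixed register, at the successive executions of a fixed instruction, holds exactly the successive BMH window positions, and if on arrival at each window exactly the occurrences at earlier positions have been reported. **Theorem.** There are one UW-RAM program that is an implementation of BMH, and one constant $C>0$, such that for all $w,\sigma,n,m$ as above the program halts on all $T$ and $P$ with all occurrences of $P$ in $T$ reported, and its total number of steps (preprocessing of $P$ included) is 1. in the worst case at most $C\cdot n\left(\frac{m\log_2\sigma}{w^2}+1\right)$; and if the packed pattern fills at least one wide word, that is $m\lceil\log_2\sigma\rceil\ge w^2$, at most $C\left(\frac{mn\log_2\sigma}{w^2}+1\right)$; 2. on average at most $C\,n$: for every pattern $P$, the mean over all $\sigma^n$ texts $T$ of length $n$ is at most $C\,n$. -/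

import Mathlib

open scoped BigOperators

/-! The ultra-wide word RAM: a word RAM with `w`-bit words (restricted instruction set) and an
additional unit working on wide words of `w ^ 2` bits. A wide word consists of `w` blocks of `w`
bits each; block `0` is the least significant one. -/

namespace UWRAM

/-- Instructions. Lower-case letters `d a b r` stand for indices of word registers, `D A B` for
indices of wide registers, `l` for positions in the program. -/
inductive Instr where
  /-- word registers: `d ← k` (immediate operand, taken modulo `2 ^ w`) -/
  | const (d k : ℕ)
  /-- `d ← a` -/
  | move (d a : ℕ)
  /-- `d ← a + b` modulo `2 ^ w` -/
  | add (d a b : ℕ)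
  /-- `d ← a - b` modulo `2 ^ w` -/
  | sub (d a b : ℕ)
  /-- `d ← a * 2 ^ b` modulo `2 ^ w` -/
  | shl (d a b : ℕ)
  /-- `d ← ⌊a / 2 ^ b⌋` -/
  | shr (d a b : ℕ)
  /-- bitwise AND -/
  | and (d a b : ℕ)
  /-- bitwise OR -/
  | or (d a b : ℕ)
  /-- bitwise NOT -/
  | not (d a : ℕ)
  /-- `d ← MEM[a]` -/
  | load (d a : ℕ)
  /-- `MEM[a] ← b` -/
  | store (a b : ℕ)
  /-- unconditional jump -/
  | jump (l : ℕ)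
  /-- jump if register `a` is zero -/
  | jumpZero (a l : ℕ)
  /-- jump if register `a` is smaller than register `b` -/
  | jumpLt (a b l : ℕ)
  /-- report the content of register `a`: append it to the output -/
  | report (a : ℕ)
  /-- stop -/
  | halt
  /-- wide registers: `D ← A + B` modulo `2 ^ (w ^ 2)` -/
  | wideAdd (D A B : ℕ)
  /-- `D ← A - B` modulo `2 ^ (w ^ 2)` -/
  | wideSub (D A B : ℕ)
  /-- `D ← A * 2 ^ b` modulo `2 ^ (w ^ 2)`, with `b` a word register -/
  | wideShl (D A b : ℕ)
  /-- `D ← ⌊A / 2 ^ b⌋`, with `b` a word register -/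
  | wideShr (D A b : ℕ)
  /-- bitwise AND -/
  | wideAnd (D A B : ℕ)
  /-- bitwise OR -/
  | wideOr (D A B : ℕ)
  /-- bitwise NOT -/
  | wideNot (D A : ℕ)
  /-- the first bits of the blocks of `A` are collected in the first block of `D` -/
  | compress (D A : ℕ)
  /-- the bits of the first block of `A` become the first bits of the blocks of `D` -/
  | spread (D A : ℕ)
  /-- jump if the wide register `A` is zero -/
  | wideJumpZero (A l : ℕ)
  /-- `D_j ← MEM[base + j]` for one `j < w` -/
  | readBlock (D j base : ℕ)
  /-- `D_j ← MEM[base + j]` for all `j < w` -/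
  | readWord (D base : ℕ)
  /-- `D_j ← MEM[base + D_j]` for all `j < w` -/
  | readContent (D base : ℕ)
  /-- `MEM[base + j] ← A_j` for one `j < w` -/
  | writeBlock (A j base : ℕ)
  /-- `MEM[base + j] ← A_j` for all `j < w` -/
  | writeWord (A base : ℕ)
  /-- `MEM[base + B_j] ← A_j` for all `j < w`; the addresses must be distinct -/
  | writeContent (A B base : ℕ)

/-- A configuration of the machine: program counter, word registers, wide registers, memory
(addressed by words), and the words reported so far. -/
structure Config (w : ℕ) where
  pc : ℕ
  reg : ℕ → BitVec w
  wide : ℕ → BitVec (w * w)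
  mem : BitVec w → BitVec w
  out : List (BitVec w)

variable {w : ℕ}

/-- The block `W_j` of a wide word. -/
def block (W : BitVec (w * w)) (j : ℕ) : BitVec w := W.extractLsb' (j * w) w

/-- The wide word whose block number `j` is `g j`, for all `j < w`. -/
def ofBlocks (g : ℕ → BitVec w) : BitVec (w * w) :=
  BitVec.ofFnLE fun k : Fin (w * w) => (g (k / w)).getLsbD (k % w)

/-- `X[j] = W_j[0]` for `j < w`, and all other bits are zero. -/
def compressWord (W : BitVec (w * w)) : BitVec (w * w) :=
  BitVec.ofFnLE fun k : Fin (w * w) => decide ((k : ℕ) < w) && W.getLsbD (k * w)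

/-- `X_j[0] = W[j]` for `j < w`, and all other bits are zero. -/
def spreadWord (W : BitVec (w * w)) : BitVec (w * w) :=
  BitVec.ofFnLE fun k : Fin (w * w) => decide ((k : ℕ) % w = 0) && W.getLsbD (k / w)

/-- Write `val j` at the address `addr j`, for all `j < w` (used for distinct addresses only). -/
def scatter (mem : BitVec w → BitVec w) (addr val : ℕ → BitVec w) : BitVec w → BitVec w :=
  fun a => match (List.range w).find? (fun j => addr j = a) with
    | some j => val j
    | none => mem a

/-- Proceed to the next instruction. -/
def Config.next (c : Config w) : Config w := { c with pc := c.pc + 1 }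

/-- Set a word register and proceed to the next instruction. -/
def Config.setReg (c : Config w) (d : ℕ) (v : BitVec w) : Config w :=
  { c.next with reg := Function.update c.reg d v }

/-- Set a wide register and proceed to the next instruction. -/
def Config.setWide (c : Config w) (D : ℕ) (v : BitVec (w * w)) : Config w :=
  { c.next with wide := Function.update c.wide D v }

/-- Replace the memory and proceed to the next instruction. -/
def Config.setMem (c : Config w) (mem : BitVec w → BitVec w) : Config w :=
  { c.next with mem := mem }

/-- Execute one instruction. There is no next configuration after `halt`, when the program counter
is outside the program, for a block index that is not smaller than `w`, and for a concurrent write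
to one address (concurrent reads are allowed). -/
def step (prog : List Instr) (c : Config w) : Option (Config w) :=
  match prog[c.pc]? with
  | none => none
  | some .halt => none
  | some (.const d k) => some (c.setReg d (BitVec.ofNat w k))
  | some (.move d a) => some (c.setReg d (c.reg a))
  | some (.add d a b) => some (c.setReg d (c.reg a + c.reg b))
  | some (.sub d a b) => some (c.setReg d (c.reg a - c.reg b))
  | some (.shl d a b) => some (c.setReg d (c.reg a <<< (c.reg b).toNat))
  | some (.shr d a b) => some (c.setReg d (c.reg a >>> (c.reg b).toNat))
  | some (.and d a b) => some (c.setReg d (c.reg a &&& c.reg b))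
  | some (.or d a b) => some (c.setReg d (c.reg a ||| c.reg b))
  | some (.not d a) => some (c.setReg d (~~~ c.reg a))
  | some (.load d a) => some (c.setReg d (c.mem (c.reg a)))
  | some (.store a b) => some (c.setMem (Function.update c.mem (c.reg a) (c.reg b)))
  | some (.jump l) => some { c with pc := l }
  | some (.jumpZero a l) => some (if c.reg a = 0 then { c with pc := l } else c.next)
  | some (.jumpLt a b l) =>
      some (if (c.reg a).toNat < (c.reg b).toNat then { c with pc := l } else c.next)
  | some (.report a) => some { c.next with out := c.out ++ [c.reg a] }
  | some (.wideAdd D A B) => some (c.setWide D (c.wide A + c.wide B))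
  | some (.wideSub D A B) => some (c.setWide D (c.wide A - c.wide B))
  | some (.wideShl D A b) => some (c.setWide D (c.wide A <<< (c.reg b).toNat))
  | some (.wideShr D A b) => some (c.setWide D (c.wide A >>> (c.reg b).toNat))
  | some (.wideAnd D A B) => some (c.setWide D (c.wide A &&& c.wide B))
  | some (.wideOr D A B) => some (c.setWide D (c.wide A ||| c.wide B))
  | some (.wideNot D A) => some (c.setWide D (~~~ c.wide A))
  | some (.compress D A) => some (c.setWide D (compressWord (c.wide A)))
  | some (.spread D A) => some (c.setWide D (spreadWord (c.wide A)))
  | some (.wideJumpZero A l) => some (if c.wide A = 0 then { c with pc := l } else c.next)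
  | some (.readBlock D j base) =>
      if (c.reg j).toNat < w then
        some (c.setWide D (ofBlocks fun i =>
          if i = (c.reg j).toNat then c.mem (c.reg base + c.reg j) else block (c.wide D) i))
      else none
  | some (.readWord D base) =>
      some (c.setWide D (ofBlocks fun i => c.mem (c.reg base + BitVec.ofNat w i)))
  | some (.readContent D base) =>
      some (c.setWide D (ofBlocks fun i => c.mem (c.reg base + block (c.wide D) i)))
  | some (.writeBlock A j base) =>
      if (c.reg j).toNat < w then
        some (c.setMem (Function.update c.mem (c.reg base + c.reg j)
          (block (c.wide A) (c.reg j).toNat)))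
      else none
  | some (.writeWord A base) =>
      some (c.setMem (scatter c.mem (fun i => c.reg base + BitVec.ofNat w i) (block (c.wide A))))
  | some (.writeContent A B base) =>
      if Function.Injective (fun i : Fin w => c.reg base + block (c.wide B) i) then
        some (c.setMem (scatter c.mem (fun i => c.reg base + block (c.wide B) i)
          (block (c.wide A))))
      else none

/-- Execute exactly `t` instructions (every instruction takes one unit of time). -/
def run (prog : List Instr) : ℕ → Config w → Option (Config w)
  | 0, c => some c
  | t + 1, c => (step prog c).bind (run prog t)

/-- The configurations, in order of time, in which the program counter is at `l`, among those
from time `0` to time `t`. -/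
def visits (prog : List Instr) (l : ℕ) : ℕ → Config w → List (Config w)
  | 0, c => if c.pc = l then [c] else []
  | t + 1, c => (if c.pc = l then [c] else []) ++
      match step prog c with
      | none => []
      | some c' => visits prog l t c'

/-- The machine has reached a `halt` instruction. -/
def Halted (prog : List Instr) (c : Config w) : Prop := prog[c.pc]? = some .halt

end UWRAM

/-! String searching and the Boyer-Moore-Horspool algorithm. Positions are counted from `0`, except
in the output, where they are counted from `1`. -/

namespace BMH

variable {σ n m : ℕ}

/-- The pattern `P` occurs in the text `T` at position `i`. -/
def OccursAt (T : Fin n → Fin σ) (P : Fin m → Fin σ) (i : ℕ) : Prop :=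
  ∃ h : i + m ≤ n, ∀ j : Fin m, T ⟨i + j, by omega⟩ = P j

instance (T : Fin n → Fin σ) (P : Fin m → Fin σ) (i : ℕ) : Decidable (OccursAt T P i) := by
  unfold OccursAt; infer_instance

/-- The occurrences of `P` in `T` at positions smaller than `k`, in increasing order and
counted from `1`. -/
def occurrencesBefore (T : Fin n → Fin σ) (P : Fin m → Fin σ) (k : ℕ) : List ℕ :=
  ((List.range k).filter fun i => OccursAt T P i).map (· + 1)

/-- All occurrences of `P` in `T`, in increasing order and counted from `1`. -/
def occurrences (T : Fin n → Fin σ) (P : Fin m → Fin σ) : List ℕ := occurrencesBefore T P (n + 1)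

/-- The shift for a window whose last character is `a`. With characters of `P` counted from `1`
it is `m - j`, where `j` is the position of the last occurrence of `a` in `P[1..m-1]`, and
it is `m` if there is no such occurrence. -/
def shift (P : Fin m → Fin σ) (a : Fin σ) : ℕ :=
  m - (Finset.univ.filter fun j : Fin m => (j : ℕ) + 1 < m ∧ P j = a).sup fun j => (j : ℕ) + 1

theorem shift_pos (P : Fin m → Fin σ) (a : Fin σ) (hm : 0 < m) : 0 < shift P a := by
  unfold shift
  rw [Nat.sub_pos_iff_lt, Finset.sup_lt_iff hm]
  intro j hj
  exact (Finset.mem_filter.mp hj).2.1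

/-- The window positions that the Boyer-Moore-Horspool algorithm visits from the window at `i`
on: the window at `i` is followed by the one at `i` plus the shift of its last character,
until the window leaves the text. -/
def windowsFrom (T : Fin n → Fin σ) (P : Fin m → Fin σ) (i : ℕ) : List ℕ :=
  if h : 0 < m ∧ i + m ≤ n then
    i :: windowsFrom T P (i + shift P (T ⟨i + m - 1, by omega⟩))
  else []
termination_by n + 1 - i
decreasing_by
  have := shift_pos P (T ⟨i + m - 1, by omega⟩) h.1
  omega

/-- The bit number `k` of the string `S`, packed with `f` bits per character. -/
def packedBit {l : ℕ} (f : ℕ) (S : Fin l → Fin σ) (k : ℕ) : Bool :=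
  if h : k / f < l then (S ⟨k / f, h⟩ : ℕ).testBit (k % f) else false

/-- The number of bits per character, `⌈log₂ σ⌉`. -/
def charBits (σ : ℕ) : ℕ := Nat.clog 2 σ

/-- The number of `w`-bit words of a packed string of length `l`. -/
def packedWords (w σ l : ℕ) : ℕ := (l * charBits σ + w - 1) / w

/-- The initial configuration. The memory holds the packed text from address `0` on, then, starting
with a new word, the packed pattern, and zeros everywhere else. The registers `0, …, 5` hold `n`,
`m`, `σ`, the number of bits per character, `w` and the address of the pattern. All other
registers are zero. -/
def init (w : ℕ) (T : Fin n → Fin σ) (P : Fin m → Fin σ) : UWRAM.Config w where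
  pc := 0
  reg := fun r => BitVec.ofNat w
    ([n, m, σ, charBits σ, w, packedWords w σ n].getD r 0)
  wide := fun _ => 0
  mem := fun a => BitVec.ofFnLE fun b : Fin w =>
    if a.toNat < packedWords w σ n then packedBit (charBits σ) T (a.toNat * w + b)
    else packedBit (charBits σ) P ((a.toNat - packedWords w σ n) * w + b)
  out := []

/-- On the text `T` and the pattern `P` the program halts after exactly `t` steps and has then
reported all occurrences. It works as the Boyer-Moore-Horspool algorithm: the values of the
register `pos`, whenever the instruction number `l` is about to be executed, are the
Boyer-Moore-Horspool window positions in their order, and when it gets to a window, it has reported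
exactly the occurrences at earlier positions. -/
def RunsIn (prog : List UWRAM.Instr) (l pos w : ℕ) (T : Fin n → Fin σ) (P : Fin m → Fin σ)
    (t : ℕ) : Prop :=
  (∃ c, UWRAM.run prog t (init w T P) = some c ∧ UWRAM.Halted prog c ∧
    c.out.map BitVec.toNat = occurrences T P) ∧
  (UWRAM.visits prog l t (init w T P)).map (fun c => ((c.reg pos).toNat, c.out.map BitVec.toNat)) =
    (windowsFrom T P 0).map (fun i => (i, occurrencesBefore T P i))

end BMH

/-! Write f for `charBits σ`. The machine has no multiplication or division, so a window position i
is carried along with the word address i * f / w and the bit offset i * f % w. Preprocessing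
tabulates these pairs for 0, …, m. Moving the window by its shift s then means adding the pair of s,
with at most one carry. With a table of last positions, a window costs O(1) apart from the
comparison with the pattern.

The comparison reads w text words at once and shifts them right by the bit offset. This aligns text
and pattern but spoils part of the top block, so chunks of w - 1 words are compared, under a mask of
m * f ones that cuts off at the end of the pattern. The first differing chunk ends the comparison.
`compare_eq_zero_iff` says what one such test decides, and `not_occursAt_of_lt_shift` that no
occurrence is skipped by a shift. `Leads` turns the program into a forward symbolic execution, which
ends in `exists_runsIn`.

For the time, chunk k is reached only if the k earlier chunks agree, and then at least k characters
agree. So the chunks compared at position i are at most as many as the k < `chunks w σ m` with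
`CharsAgree T P i k`. In the worst case this is `chunks`, which `chunks_le_logb` bounds. For the
mean, at most a fraction σ⁻ᵏ ≤ 2⁻ᵏ of all texts agrees with the pattern in k prescribed places
(`card_charsAgree_mul_le`), so the mean number is at most 2 at every fixed position. Which positions
are windows depends on the text, but the time is bounded by a sum over all positions 0, …, n, and
linearity of the mean suffices. -/

namespace UWRAM


/-! ### Symbolic execution: one rule per instruction -/

/-- What is recorded of a configuration: the content of register `pos` and the output. -/
def Config.observe {w : ℕ} (pos : ℕ) (c : Config w) : ℕ × List ℕ :=
  ((c.reg pos).toNat, c.out.map BitVec.toNat)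

/-- From `c` the program `prog` reaches within `b` steps a configuration with the property `Q`, and
`v` is what is recorded before that, whenever the program counter is at `l`. -/
def Leads {w : ℕ} (prog : List Instr) (l pos : ℕ) (c : Config w) (v : List (ℕ × List ℕ)) (b : ℕ)
    (Q : Config w → Prop) : Prop :=
  ∃ t c', t ≤ b ∧ (∀ s, run prog (s + t) c = run prog s c') ∧
    (∀ s, (visits prog l (s + t) c).map (Config.observe pos) =
      v ++ (visits prog l s c').map (Config.observe pos)) ∧ Q c'

namespace Leads

variable {w : ℕ} {prog : List Instr} {l pos p b d r s : ℕ} {R : ℕ → BitVec w}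
  {W : ℕ → BitVec (w * w)} {M : BitVec w → BitVec w} {o : List (BitVec w)}
  {v : List (ℕ × List ℕ)} {Q : Config w → Prop}

theorem done {c : Config w} (h : Q c) : Leads prog l pos c [] b Q :=
  ⟨0, c, Nat.zero_le _, fun _ => rfl, fun _ => rfl, h⟩

theorem mono {c : Config w} {b' : ℕ} (h : Leads prog l pos c v b Q) (hb : b ≤ b') :
    Leads prog l pos c v b' Q := by
  obtain ⟨t, c', ht, h⟩ := h
  exact ⟨t, c', ht.trans hb, h⟩

theorem cons {c c' : Config w} (hs : step prog c = some c') (hl : c.pc ≠ l)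
    (h : Leads prog l pos c' v b Q) : Leads prog l pos c v (b + 1) Q := by
  obtain ⟨t, c'', ht, h1, h2, h3⟩ := h
  refine ⟨t + 1, c'', by omega, fun s => ?_, fun s => ?_, h3⟩
  · rw [← add_assoc, run, hs]; exact h1 s
  · rw [← add_assoc, visits, hs, if_neg hl]; exact h2 s

theorem cons_visit {c c' : Config w} (hs : step prog c = some c') (hl : c.pc = l)
    (h : Leads prog l pos c' v b Q) : Leads prog l pos c (c.observe pos :: v) (b + 1) Q := by
  obtain ⟨t, c'', ht, h1, h2, h3⟩ := h
  refine ⟨t + 1, c'', by omega, fun s => ?_, fun s => ?_, h3⟩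
  · rw [← add_assoc, run, hs]; exact h1 s
  · rw [← add_assoc, visits, hs, if_pos hl]; simp [h2 s]

theorem const {k : ℕ} (hi : prog[p]? = some (.const d k)) (hl : p ≠ l)
    (h : Leads prog l pos ⟨p + 1, Function.update R d (BitVec.ofNat w k), W, M, o⟩ v b Q) :
    Leads prog l pos ⟨p, R, W, M, o⟩ v (b + 1) Q :=
  cons (by simp only [step, hi]; rfl) hl h

/-- Register contents are carried as `BitVec.ofNat` of true natural numbers. Addition is compatible
with reduction modulo 2 ^ w without any bound, so bounds are needed only where the natural value is
read off: in shift amounts and in conditional jumps. -/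
theorem add {x y : ℕ} (hi : prog[p]? = some (.add d r s)) (hl : p ≠ l)
    (hr : R r = BitVec.ofNat w x) (hs : R s = BitVec.ofNat w y)
    (h : Leads prog l pos ⟨p + 1, Function.update R d (BitVec.ofNat w (x + y)), W, M, o⟩ v b Q) :
    Leads prog l pos ⟨p, R, W, M, o⟩ v (b + 1) Q :=
  cons (by simp only [step, hi, hr, hs, ← BitVec.ofNat_add]; rfl) hl h

theorem _root_.BitVec.ofNat_sub_ofNat_of_le_right {w x y : ℕ} (h : y ≤ x) :
    BitVec.ofNat w x - BitVec.ofNat w y = BitVec.ofNat w (x - y) := by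
  rw [BitVec.sub_eq_iff_eq_add, ← BitVec.ofNat_add, Nat.sub_add_cancel h]

theorem sub {x y : ℕ} (hi : prog[p]? = some (.sub d r s)) (hl : p ≠ l)
    (hr : R r = BitVec.ofNat w x) (hs : R s = BitVec.ofNat w y) (hyx : y ≤ x)
    (h : Leads prog l pos ⟨p + 1, Function.update R d (BitVec.ofNat w (x - y)), W, M, o⟩ v b Q) :
    Leads prog l pos ⟨p, R, W, M, o⟩ v (b + 1) Q :=
  cons (by simp only [step, hi, hr, hs, BitVec.ofNat_sub_ofNat_of_le_right hyx]; rfl) hl h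

theorem shl {x : BitVec w} {y : ℕ} (hi : prog[p]? = some (.shl d r s)) (hl : p ≠ l)
    (hr : R r = x) (hs : R s = BitVec.ofNat w y) (hy : y < 2 ^ w)
    (h : Leads prog l pos ⟨p + 1, Function.update R d (x <<< y), W, M, o⟩ v b Q) :
    Leads prog l pos ⟨p, R, W, M, o⟩ v (b + 1) Q :=
  cons (by simp only [step, hi, hr, hs, BitVec.toNat_ofNat, Nat.mod_eq_of_lt hy]; rfl) hl h

theorem shr {x : BitVec w} {y : ℕ} (hi : prog[p]? = some (.shr d r s)) (hl : p ≠ l)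
    (hr : R r = x) (hs : R s = BitVec.ofNat w y) (hy : y < 2 ^ w)
    (h : Leads prog l pos ⟨p + 1, Function.update R d (x >>> y), W, M, o⟩ v b Q) :
    Leads prog l pos ⟨p, R, W, M, o⟩ v (b + 1) Q :=
  cons (by simp only [step, hi, hr, hs, BitVec.toNat_ofNat, Nat.mod_eq_of_lt hy]; rfl) hl h

theorem and {x y z : BitVec w} (hi : prog[p]? = some (.and d r s)) (hl : p ≠ l)
    (hr : R r = x) (hs : R s = y) (hz : x &&& y = z)
    (h : Leads prog l pos ⟨p + 1, Function.update R d z, W, M, o⟩ v b Q) :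
    Leads prog l pos ⟨p, R, W, M, o⟩ v (b + 1) Q :=
  cons (by simp only [step, hi, hr, hs, hz]; rfl) hl h

theorem or {x y : BitVec w} (hi : prog[p]? = some (.or d r s)) (hl : p ≠ l)
    (hr : R r = x) (hs : R s = y)
    (h : Leads prog l pos ⟨p + 1, Function.update R d (x ||| y), W, M, o⟩ v b Q) :
    Leads prog l pos ⟨p, R, W, M, o⟩ v (b + 1) Q :=
  cons (by simp only [step, hi, hr, hs]; rfl) hl h

theorem not {x : BitVec w} (hi : prog[p]? = some (.not d r)) (hl : p ≠ l)
    (hr : R r = x)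
    (h : Leads prog l pos ⟨p + 1, Function.update R d (~~~ x), W, M, o⟩ v b Q) :
    Leads prog l pos ⟨p, R, W, M, o⟩ v (b + 1) Q :=
  cons (by simp only [step, hi, hr]; rfl) hl h

theorem load {x : ℕ} {y : BitVec w} (hi : prog[p]? = some (.load d r)) (hl : p ≠ l)
    (hr : R r = BitVec.ofNat w x) (hM : M (BitVec.ofNat w x) = y)
    (h : Leads prog l pos ⟨p + 1, Function.update R d y, W, M, o⟩ v b Q) :
    Leads prog l pos ⟨p, R, W, M, o⟩ v (b + 1) Q :=
  cons (by simp only [step, hi, hr, hM]; rfl) hl h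

theorem store {x : ℕ} {y : BitVec w} (hi : prog[p]? = some (.store r s)) (hl : p ≠ l)
    (hr : R r = BitVec.ofNat w x) (hs : R s = y)
    (h : Leads prog l pos ⟨p + 1, R, W, Function.update M (BitVec.ofNat w x) y, o⟩ v b Q) :
    Leads prog l pos ⟨p, R, W, M, o⟩ v (b + 1) Q :=
  cons (by simp only [step, hi, hr, hs]; rfl) hl h

theorem jump {q : ℕ} (hi : prog[p]? = some (.jump q)) (hl : p ≠ l)
    (h : Leads prog l pos ⟨q, R, W, M, o⟩ v b Q) :
    Leads prog l pos ⟨p, R, W, M, o⟩ v (b + 1) Q :=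
  cons (by simp only [step, hi]) hl h

theorem _root_.BitVec.ofNat_eq_zero_iff_of_lt {w x : ℕ} (h : x < 2 ^ w) :
    BitVec.ofNat w x = 0 ↔ x = 0 := by
  rw [← BitVec.toNat_inj, BitVec.toNat_ofNat, Nat.mod_eq_of_lt h]; simp

theorem jumpZero {x q : ℕ} (hi : prog[p]? = some (.jumpZero r q)) (hl : p ≠ l)
    (hr : R r = BitVec.ofNat w x) (hx : x < 2 ^ w)
    (h : x = 0 → Leads prog l pos ⟨q, R, W, M, o⟩ v b Q)
    (h' : x ≠ 0 → Leads prog l pos ⟨p + 1, R, W, M, o⟩ v b Q) :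
    Leads prog l pos ⟨p, R, W, M, o⟩ v (b + 1) Q := by
  by_cases h0 : x = 0
  · exact cons (by simp only [step, hi, hr, BitVec.ofNat_eq_zero_iff_of_lt hx, if_pos h0]) hl (h h0)
  · exact cons (by simp only [step, hi, hr, BitVec.ofNat_eq_zero_iff_of_lt hx, if_neg h0]; rfl) hl
      (h' h0)

theorem jumpLt {x y q : ℕ} (hi : prog[p]? = some (.jumpLt r s q)) (hl : p ≠ l)
    (hr : R r = BitVec.ofNat w x) (hs : R s = BitVec.ofNat w y) (hx : x < 2 ^ w) (hy : y < 2 ^ w)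
    (h : x < y → Leads prog l pos ⟨q, R, W, M, o⟩ v b Q)
    (h' : y ≤ x → Leads prog l pos ⟨p + 1, R, W, M, o⟩ v b Q) :
    Leads prog l pos ⟨p, R, W, M, o⟩ v (b + 1) Q := by
  by_cases h0 : x < y
  · exact cons (by simp only [step, hi, hr, hs, BitVec.toNat_ofNat, Nat.mod_eq_of_lt hx,
      Nat.mod_eq_of_lt hy, if_pos h0]) hl (h h0)
  · exact cons (by simp only [step, hi, hr, hs, BitVec.toNat_ofNat, Nat.mod_eq_of_lt hx,
      Nat.mod_eq_of_lt hy, if_neg h0]; rfl) hl (h' (not_lt.mp h0))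

theorem report {x : BitVec w} (hi : prog[p]? = some (.report r)) (hl : p ≠ l)
    (hr : R r = x) (h : Leads prog l pos ⟨p + 1, R, W, M, o ++ [x]⟩ v b Q) :
    Leads prog l pos ⟨p, R, W, M, o⟩ v (b + 1) Q :=
  cons (by simp only [step, hi, hr]; rfl) hl h

theorem readWord {x : ℕ} (hi : prog[p]? = some (.readWord d r)) (hl : p ≠ l)
    (hr : R r = BitVec.ofNat w x)
    (h : Leads prog l pos ⟨p + 1, R, Function.update W d
      (ofBlocks fun i => M (BitVec.ofNat w (x + i))), M, o⟩ v b Q) :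
    Leads prog l pos ⟨p, R, W, M, o⟩ v (b + 1) Q :=
  cons (by simp only [step, hi, hr, ← BitVec.ofNat_add]; rfl) hl h

theorem wideShl {x : BitVec (w * w)} {y : ℕ} (hi : prog[p]? = some (.wideShl d r s)) (hl : p ≠ l)
    (hr : W r = x) (hs : R s = BitVec.ofNat w y) (hy : y < 2 ^ w)
    (h : Leads prog l pos ⟨p + 1, R, Function.update W d (x <<< y), M, o⟩ v b Q) :
    Leads prog l pos ⟨p, R, W, M, o⟩ v (b + 1) Q :=
  cons (by simp only [step, hi, hr, hs, BitVec.toNat_ofNat, Nat.mod_eq_of_lt hy]; rfl) hl h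

theorem wideShr {x : BitVec (w * w)} {y : ℕ} (hi : prog[p]? = some (.wideShr d r s)) (hl : p ≠ l)
    (hr : W r = x) (hs : R s = BitVec.ofNat w y) (hy : y < 2 ^ w)
    (h : Leads prog l pos ⟨p + 1, R, Function.update W d (x >>> y), M, o⟩ v b Q) :
    Leads prog l pos ⟨p, R, W, M, o⟩ v (b + 1) Q :=
  cons (by simp only [step, hi, hr, hs, BitVec.toNat_ofNat, Nat.mod_eq_of_lt hy]; rfl) hl h

theorem wideAnd {x y : BitVec (w * w)} (hi : prog[p]? = some (.wideAnd d r s)) (hl : p ≠ l)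
    (hr : W r = x) (hs : W s = y)
    (h : Leads prog l pos ⟨p + 1, R, Function.update W d (x &&& y), M, o⟩ v b Q) :
    Leads prog l pos ⟨p, R, W, M, o⟩ v (b + 1) Q :=
  cons (by simp only [step, hi, hr, hs]; rfl) hl h

theorem wideSub {x y : BitVec (w * w)} (hi : prog[p]? = some (.wideSub d r s)) (hl : p ≠ l)
    (hr : W r = x) (hs : W s = y)
    (h : Leads prog l pos ⟨p + 1, R, Function.update W d (x - y), M, o⟩ v b Q) :
    Leads prog l pos ⟨p, R, W, M, o⟩ v (b + 1) Q :=
  cons (by simp only [step, hi, hr, hs]; rfl) hl h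

theorem wideJumpZero {x : BitVec (w * w)} {q : ℕ} (hi : prog[p]? = some (.wideJumpZero r q))
    (hl : p ≠ l) (hr : W r = x)
    (h : x = 0 → Leads prog l pos ⟨q, R, W, M, o⟩ v b Q)
    (h' : x ≠ 0 → Leads prog l pos ⟨p + 1, R, W, M, o⟩ v b Q) :
    Leads prog l pos ⟨p, R, W, M, o⟩ v (b + 1) Q := by
  by_cases h0 : x = 0
  · exact cons (by simp only [step, hi, hr, if_pos h0]) hl (h h0)
  · exact cons (by simp only [step, hi, hr, if_neg h0]; rfl) hl (h' h0)

end Leads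

end UWRAM

/-! ### The program and the numerical bounds on its parameters -/

namespace BMH

open UWRAM

/-- The search program. Registers `6, …, 12` get the constants `1`, `K = n + m + σ` (the base of the
table of last positions), `2 * K`, `3 * K` (the bases of the tables of word addresses and of bit
offsets), `4 * K` (the base of the mask of the pattern) and the masks of a character and of a word.
Registers `13, …, 16` get the number of mask words, `w - 1` and the address and offset of the last
character in a window; registers `17, 18, 19` hold a position and its address and offset.
Instruction `53` is executed once for each window. -/
def searchProgram : List UWRAM.Instr := [
  .const 6 1, .add 20 0 1, .add 7 20 2, .add 8 7 7, .add 9 8 7,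
  .add 10 9 7, .shl 21 6 3, .sub 11 21 6, .not 12 22, .add 20 8 17,
  .store 20 18, .add 21 9 17, .store 21 19, .sub 22 1 17, .jumpZero 22 37,
  .sub 23 22 6, .jumpZero 23 29, .add 24 5 18, .load 25 24, .shr 26 25 19,
  .add 27 24 6, .load 28 27, .sub 29 4 19, .shl 30 28 29, .or 31 26 30,
  .and 32 31 11, .add 33 7 32, .add 34 17 6, .store 33 34, .add 17 17 6,
  .add 19 19 3, .jumpLt 19 4 9, .add 20 10 18, .store 20 12, .sub 19 19 4,
  .add 18 18 6, .jump 9, .shl 20 6 19, .sub 21 20 6, .add 22 10 18,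
  .store 22 21, .add 13 18 6, .sub 14 4 6, .sub 23 1 6, .add 24 8 23,
  .load 15 24, .add 25 9 23, .load 16 25, .const 17 0, .const 18 0,
  .const 19 0, .add 20 17 1, .jumpLt 0 20 99, .const 21 0, .add 22 18 21,
  .readWord 0 22, .wideShr 1 0 19, .add 23 5 21, .readWord 2 23, .add 24 10 21,
  .readWord 3 24, .wideShl 4 3 4, .wideShr 5 4 4, .wideAnd 6 1 5, .wideAnd 7 2 5,
  .wideSub 8 6 7, .wideJumpZero 8 68, .jump 72, .add 21 21 14, .jumpLt 21 13 54,
  .add 25 17 6, .report 25, .add 26 18 15, .add 27 19 16, .jumpLt 27 4 77,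
  .sub 27 27 4, .add 26 26 6, .load 28 26, .shr 29 28 27, .add 30 26 6,
  .load 31 30, .sub 32 4 27, .shl 33 31 32, .or 34 29 33, .and 35 34 11,
  .add 36 7 35, .load 37 36, .sub 38 1 37, .add 17 17 38, .add 39 8 38,
  .load 40 39, .add 18 18 40, .add 41 9 38, .load 42 41, .add 19 19 42,
  .jumpLt 19 4 51, .sub 19 19 4, .add 18 18 6, .jump 51, .halt]


variable {w σ n m : ℕ}

/-- The sizes to which the theorem applies. -/
structure Admissible (w σ n m : ℕ) : Prop where
  two_le : 2 ≤ σ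
  pos : 1 ≤ m
  le : m ≤ n
  bound : 16 * (n + m + σ) ≤ 2 ^ w

namespace Admissible

theorem six_le (h : Admissible w σ n m) : 6 ≤ w := by
  have h1 : 2 ^ 6 ≤ 2 ^ w := le_trans (by have := h.two_le; have := h.pos; have := h.le; omega) h.bound
  exact (Nat.pow_le_pow_iff_right (by norm_num)).mp h1

/-- A wide read at the mask table runs up to w words past the table. This bound, together with 16 *
(n + m + σ) ≤ 2 ^ w, keeps those addresses from wrapping around. -/
theorem word_le (h : Admissible w σ n m) : 2 * w ≤ 2 ^ w := by
  have h1 := Nat.lt_two_pow_self (n := w - 1)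
  have h2 : 2 ^ w = 2 * 2 ^ (w - 1) := by
    rw [← pow_succ']; congr 1; have := h.six_le; omega
  omega

theorem charBits_le (h : Admissible w σ n m) : charBits σ ≤ w :=
  Nat.clog_le_of_le_pow (by have := h.bound; omega)

theorem charBits_pos (h : Admissible w σ n m) : 0 < charBits σ :=
  Nat.clog_pos (by norm_num) h.two_le

theorem le_pow_charBits (σ : ℕ) : σ ≤ 2 ^ charBits σ := Nat.le_pow_clog (by norm_num) _

theorem packedWords_le (h : Admissible w σ n m) (l : ℕ) : packedWords w σ l ≤ l := by
  have := h.six_le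
  have h1 : l * charBits σ ≤ l * w := Nat.mul_le_mul_left _ h.charBits_le
  rw [packedWords, ← Nat.lt_succ_iff, Nat.div_lt_iff_lt_mul (by omega), Nat.succ_mul]
  omega

theorem mul_charBits_div_le (h : Admissible w σ n m) (l : ℕ) : l * charBits σ / w ≤ l := by
  have := h.six_le
  exact Nat.div_le_of_le_mul (by rw [mul_comm w]; exact Nat.mul_le_mul_left _ h.charBits_le)

end Admissible

/-! ### Packed characters and the tables in memory -/

/-- A character may straddle two words: its low bits come from `A` and the rest from `B`. For r = 0
the second shift is by the full w and contributes nothing, so no case distinction is needed in the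
program. -/
theorem extract_bits {A B : BitVec w} {r f x : ℕ} (hr : r < w) (hx : x < 2 ^ f)
    (hb : ∀ t < f, (if r + t < w then A.getLsbD (r + t) else B.getLsbD (r + t - w)) = x.testBit t) :
    (A >>> r ||| B <<< (w - r)) &&& BitVec.ofNat w (2 ^ f - 1) = BitVec.ofNat w x := by
  refine BitVec.eq_of_getLsbD_eq fun t ht => ?_
  simp only [BitVec.getLsbD_and, BitVec.getLsbD_or, BitVec.getLsbD_ushiftRight,
    BitVec.getLsbD_shiftLeft, BitVec.getLsbD_ofNat, Nat.testBit_two_pow_sub_one]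
  by_cases h : t < f
  · rw [← hb t h]
    by_cases h1 : r + t < w
    · simp [h, ht, h1, show t < w - r by omega]
    · simp [h, ht, h1, show ¬ t < w - r by omega, show t - (w - r) = r + t - w by omega,
        BitVec.getLsbD_of_ge A (r + t) (by omega)]
  · have h2 : x.testBit t = false :=
      Nat.testBit_lt_two_pow (hx.trans_le (Nat.pow_le_pow_right (by norm_num) (by omega)))
    simp [h, h2]

theorem packedBit_mul_add {l f : ℕ} (S : Fin l → Fin σ) (i : Fin l) {t : ℕ} (ht : t < f) :
    packedBit f S (i * f + t) = (S i : ℕ).testBit t := by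
  have h1 : (i * f + t) / f = i := by
    rw [mul_comm, Nat.mul_add_div (by omega), Nat.div_eq_of_lt ht, add_zero]
  have h2 : (i * f + t) % f = t := by
    rw [mul_comm, Nat.mul_add_mod, Nat.mod_eq_of_lt ht]
  have h3 : (i * f + t) / f < l := h1.symm ▸ i.2
  rw [packedBit, dif_pos h3, h2]
  congr 3
  exact Fin.ext h1

/-- The memory `M` holds the packed string `S` from the address `base` on. -/
def Stores (M : BitVec w → BitVec w) (base : ℕ) {l : ℕ} (S : Fin l → Fin σ) : Prop :=
  ∀ a t, t < w → a * w + t < l * charBits σ →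
    (M (BitVec.ofNat w (base + a))).getLsbD t = packedBit (charBits σ) S (a * w + t)

theorem Stores.extract {M : BitVec w → BitVec w} {base l : ℕ} {S : Fin l → Fin σ}
    (h : Stores M base S) {q r x : ℕ} (hf : charBits σ ≤ w) (hr : r < w) (i : Fin l)
    (hi : q * w + r = i * charBits σ) (hx : x = base + q) :
    ((M (BitVec.ofNat w x)) >>> r ||| (M (BitVec.ofNat w (x + 1))) <<< (w - r)) &&&
      BitVec.ofNat w (2 ^ charBits σ - 1) = BitVec.ofNat w (S i) := by
  have hl : (i + 1) * charBits σ ≤ l * charBits σ := Nat.mul_le_mul_right _ i.2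
  rw [Nat.succ_mul] at hl
  refine extract_bits hr ((S i).2.trans_le (Admissible.le_pow_charBits σ)) fun t ht => ?_
  rw [← packedBit_mul_add S i ht, ← hi, hx]
  split_ifs with h1
  · rw [h q (r + t) h1 (by omega), add_assoc]
  · have h2 : (q + 1) * w = q * w + w := Nat.succ_mul q w
    rw [add_assoc base q 1, h (q + 1) (r + t - w) (by omega) (by omega)]
    congr 1
    omega

theorem update_ofNat_of_ne {α : Type*} (M : BitVec w → α) {x y : ℕ} (v : α) (hx : x < 2 ^ w)
    (hy : y < 2 ^ w) (h : y ≠ x) :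
    Function.update M (BitVec.ofNat w x) v (BitVec.ofNat w y) = M (BitVec.ofNat w y) := by
  refine Function.update_of_ne (fun h1 => h ?_) _ _
  have h2 := congrArg BitVec.toNat h1
  rwa [BitVec.toNat_ofNat, BitVec.toNat_ofNat, Nat.mod_eq_of_lt hx, Nat.mod_eq_of_lt hy] at h2

theorem Stores.update (hA : Admissible w σ n m) {M : BitVec w → BitVec w} {base l : ℕ}
    {S : Fin l → Fin σ} (h : Stores M base S) {x : ℕ} {v : BitVec w} (hl : base + l ≤ x)
    (hx : x < 2 ^ w) : Stores (Function.update M (BitVec.ofNat w x) v) base S := by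
  intro a t ht hat
  -- A character has at most w bits, so a string of length l lies in its first l words, below the
  -- address that is written.
  have h1 : a < l := by
    have h2 : l * charBits σ ≤ l * w := Nat.mul_le_mul_left _ hA.charBits_le
    exact Nat.lt_of_mul_lt_mul_right (show a * w < l * w by omega)
  rw [update_ofNat_of_ne M v hx (by omega) (by omega)]
  exact h a t ht hat

/-- The last position, counted from `1`, of the character `a` among the first `k` characters and
the first `m - 1` characters of `P`. -/
def lastBefore (P : Fin m → Fin σ) (k a : ℕ) : ℕ :=
  (Finset.univ.filter fun j : Fin m => (j : ℕ) < k ∧ (j : ℕ) + 1 < m ∧ (P j : ℕ) = a).sup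
    fun j => (j : ℕ) + 1

theorem lastBefore_zero (P : Fin m → Fin σ) (a : ℕ) : lastBefore P 0 a = 0 := by
  simp [lastBefore]

theorem lastBefore_le (P : Fin m → Fin σ) (k a : ℕ) : lastBefore P k a ≤ m :=
  Finset.sup_le fun j _ => j.2

theorem lastBefore_succ_of_last (P : Fin m → Fin σ) {k : ℕ} (hk : k + 1 = m) (a : ℕ) :
    lastBefore P (k + 1) a = lastBefore P k a := by
  unfold lastBefore
  congr 1
  ext j
  simp only [Finset.mem_filter, Finset.mem_univ, true_and]
  constructor <;> rintro ⟨h1, h2, h3⟩ <;> exact ⟨by omega, h2, h3⟩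

/-- Scanning from left to right, the newest position is the largest one, so the table is maintained
by overwriting. -/
theorem lastBefore_succ (P : Fin m → Fin σ) {k : ℕ} (hk : k + 1 < m) (a : ℕ) :
    lastBefore P (k + 1) a = if a = P ⟨k, by omega⟩ then k + 1 else lastBefore P k a := by
  unfold lastBefore
  split_ifs with h
  · refine le_antisymm (Finset.sup_le fun j hj => ?_) ?_
    · have := (Finset.mem_filter.mp hj).2.1; omega
    · exact Finset.le_sup (f := fun j : Fin m => (j : ℕ) + 1) (b := ⟨k, by omega⟩)
        (by simp [h, hk])
  · congr 1
    ext j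
    simp only [Finset.mem_filter, Finset.mem_univ, true_and]
    constructor
    · rintro ⟨h1, h2, h3⟩
      refine ⟨lt_of_le_of_ne (by omega) fun h4 => h ?_, h2, h3⟩
      rw [← h3]; congr 2; exact Fin.ext h4
    · rintro ⟨h1, h2, h3⟩; exact ⟨by omega, h2, h3⟩

theorem sub_lastBefore (P : Fin m → Fin σ) (a : Fin σ) : m - lastBefore P m a = shift P a := by
  unfold lastBefore shift
  congr 2
  ext j
  simp [Fin.ext_iff]

/-- The content of the memory: text, pattern, the last positions of the characters among the first
`j` ones of the pattern, the addresses and the offsets of the first `jq` and `jr` characters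
relative to the first one, and a mask of `μ` ones. -/
structure Tables (T : Fin n → Fin σ) (P : Fin m → Fin σ) (j jq jr μ : ℕ)
    (M : BitVec w → BitVec w) : Prop where
  text : Stores M 0 T
  pattern : Stores M (packedWords w σ n) P
  last : ∀ c < σ, M (BitVec.ofNat w (n + m + σ + c)) = BitVec.ofNat w (lastBefore P j c)
  address : ∀ i < jq, M (BitVec.ofNat w (2 * (n + m + σ) + i)) = BitVec.ofNat w (i * charBits σ / w)
  offset : ∀ i < jr, M (BitVec.ofNat w (3 * (n + m + σ) + i)) = BitVec.ofNat w (i * charBits σ % w)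
  mask : ∀ a ≤ m + w, ∀ t < w,
    (M (BitVec.ofNat w (4 * (n + m + σ) + a))).getLsbD t = decide (a * w + t < μ)

namespace Tables

variable {T : Fin n → Fin σ} {P : Fin m → Fin σ} {j jq jr μ : ℕ} {M : BitVec w → BitVec w}

theorem init (hA : Admissible w σ n m) : Tables T P 0 0 0 0 (init w T P).mem := by
  have hw := hA.six_le
  have hb := hA.bound
  have hww := hA.word_le
  have hn := hA.packedWords_le n
  -- Beyond text and pattern the memory is zero: the bit index relative to the pattern is at least m
  -- * w, hence past its m * f bits. So all tables start out cleared.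
  have hz : ∀ x, n + m + σ ≤ x → x < 2 ^ w → (BMH.init w T P).mem (BitVec.ofNat w x) = 0 := by
    intro x h1 h2
    ext t ht
    have h3 : ¬ ((x - packedWords w σ n) * w + t) / charBits σ < m := by
      rw [not_lt, Nat.le_div_iff_mul_le hA.charBits_pos]
      calc m * charBits σ ≤ m * w := Nat.mul_le_mul_left _ hA.charBits_le
        _ ≤ (x - packedWords w σ n) * w := Nat.mul_le_mul_right _ (by omega)
        _ ≤ _ := Nat.le_add_right _ _
    simp [BMH.init, Nat.mod_eq_of_lt h2, show ¬ x < packedWords w σ n by omega, packedBit, h3]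
  have hlt : ∀ l a t, t < w → a * w + t < l * charBits σ → a < packedWords w σ l := by
    intro l a t ht hat
    rw [packedWords, ← Nat.succ_le_iff, Nat.le_div_iff_mul_le (by omega), Nat.succ_mul]
    omega
  refine ⟨fun a t ht hat => ?_, fun a t ht hat => ?_, fun c hc => ?_, fun i hi => by omega,
    fun i hi => by omega, fun a ha t ht => ?_⟩
  · have h1 := hlt n a t ht hat
    simp [BMH.init, Nat.mod_eq_of_lt (show a < 2 ^ w by omega), h1, ht]
  · have h1 := hlt m a t ht hat
    have h2 := hA.packedWords_le m
    simp [BMH.init, Nat.mod_eq_of_lt (show packedWords w σ n + a < 2 ^ w by omega), ht]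
  · rw [hz _ (by omega) (by omega), lastBefore_zero]; rfl
  · rw [hz _ (by omega) (by omega)]; simp

/-- The tables start at multiples of n + m + σ, and the entries written are fewer than that in each,
so a store into one table leaves the others and both strings intact. The three lemmas that follow
rest on the same separation. -/
theorem store_last (hA : Admissible w σ n m) (h : Tables T P j jq jr μ M) (hjq : jq ≤ m + 1)
    (hjr : jr ≤ m + 1) (hj : j + 1 < m) :
    Tables T P (j + 1) jq jr μ (Function.update M
      (BitVec.ofNat w (n + m + σ + P ⟨j, by omega⟩)) (BitVec.ofNat w (j + 1))) := by
  have hP := (P ⟨j, by omega⟩).2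
  have hb := hA.bound
  have hww := hA.word_le
  have hn := hA.packedWords_le n
  refine ⟨h.text.update hA (by omega) (by omega), h.pattern.update hA (by omega) (by omega),
    fun c hc => ?_, fun i hi => ?_, fun i hi => ?_, fun a ha t ht => ?_⟩
  · rw [lastBefore_succ P hj]
    split_ifs with h1
    · rw [h1, Function.update_self]
    · rw [update_ofNat_of_ne _ _ (by omega) (by omega) (by omega), h.last c hc]
  · rw [update_ofNat_of_ne _ _ (by omega) (by omega) (by omega), h.address i hi]
  · rw [update_ofNat_of_ne _ _ (by omega) (by omega) (by omega), h.offset i hi]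
  · rw [update_ofNat_of_ne _ _ (by omega) (by omega) (by omega), h.mask a ha t ht]

theorem store_address (hA : Admissible w σ n m) (h : Tables T P j jq jr μ M) (hjq : jq ≤ m)
    (hjr : jr ≤ m + 1) :
    Tables T P j (jq + 1) jr μ (Function.update M
      (BitVec.ofNat w (2 * (n + m + σ) + jq)) (BitVec.ofNat w (jq * charBits σ / w))) := by
  have hb := hA.bound
  have hww := hA.word_le
  have hσ := hA.two_le
  have hn := hA.packedWords_le n
  refine ⟨h.text.update hA (by omega) (by omega), h.pattern.update hA (by omega) (by omega),
    fun c hc => ?_, fun i hi => ?_, fun i hi => ?_, fun a ha t ht => ?_⟩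
  · rw [update_ofNat_of_ne _ _ (by omega) (by omega) (by omega), h.last c hc]
  · rcases Nat.lt_succ_iff_lt_or_eq.mp hi with h1 | h1
    · rw [update_ofNat_of_ne _ _ (by omega) (by omega) (by omega), h.address i h1]
    · rw [h1, Function.update_self]
  · rw [update_ofNat_of_ne _ _ (by omega) (by omega) (by omega), h.offset i hi]
  · rw [update_ofNat_of_ne _ _ (by omega) (by omega) (by omega), h.mask a ha t ht]

theorem store_offset (hA : Admissible w σ n m) (h : Tables T P j jq jr μ M) (hjq : jq ≤ m + 1)
    (hjr : jr ≤ m) :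
    Tables T P j jq (jr + 1) μ (Function.update M
      (BitVec.ofNat w (3 * (n + m + σ) + jr)) (BitVec.ofNat w (jr * charBits σ % w))) := by
  have hb := hA.bound
  have hww := hA.word_le
  have hσ := hA.two_le
  have hn := hA.packedWords_le n
  refine ⟨h.text.update hA (by omega) (by omega), h.pattern.update hA (by omega) (by omega),
    fun c hc => ?_, fun i hi => ?_, fun i hi => ?_, fun a ha t ht => ?_⟩
  · rw [update_ofNat_of_ne _ _ (by omega) (by omega) (by omega), h.last c hc]
  · rw [update_ofNat_of_ne _ _ (by omega) (by omega) (by omega), h.address i hi]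
  · rcases Nat.lt_succ_iff_lt_or_eq.mp hi with h1 | h1
    · rw [update_ofNat_of_ne _ _ (by omega) (by omega) (by omega), h.offset i h1]
    · rw [h1, Function.update_self]
  · rw [update_ofNat_of_ne _ _ (by omega) (by omega) (by omega), h.mask a ha t ht]

/-- Serves both for full mask words (r = w) and for the last, partial one (r = m * f % w). -/
theorem store_mask (hA : Admissible w σ n m) {q r : ℕ} (h : Tables T P j jq jr (q * w) M)
    (hjq : jq ≤ m + 1) (hjr : jr ≤ m + 1) (hq : q ≤ m) (hr : r ≤ w) {v : BitVec w}
    (hv : ∀ t < w, v.getLsbD t = decide (t < r)) :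
    Tables T P j jq jr (q * w + r) (Function.update M (BitVec.ofNat w (4 * (n + m + σ) + q)) v) := by
  have hb := hA.bound
  have hww := hA.word_le
  have hσ := hA.two_le
  have hn := hA.packedWords_le n
  refine ⟨h.text.update hA (by omega) (by omega), h.pattern.update hA (by omega) (by omega),
    fun c hc => ?_, fun i hi => ?_, fun i hi => ?_, fun a ha t ht => ?_⟩
  · rw [update_ofNat_of_ne _ _ (by omega) (by omega) (by omega), h.last c hc]
  · rw [update_ofNat_of_ne _ _ (by omega) (by omega) (by omega), h.address i hi]
  · rw [update_ofNat_of_ne _ _ (by omega) (by omega) (by omega), h.offset i hi]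
  · rcases lt_trichotomy a q with h1 | h1 | h1
    · have h2 : (a + 1) * w ≤ q * w := Nat.mul_le_mul_right _ h1
      rw [Nat.succ_mul] at h2
      rw [update_ofNat_of_ne _ _ (by omega) (by omega) (by omega), h.mask a ha t ht, decide_eq_decide]
      omega
    · rw [h1, Function.update_self, hv t ht, decide_eq_decide]
      omega
    · have h2 : (q + 1) * w ≤ a * w := Nat.mul_le_mul_right _ h1
      rw [Nat.succ_mul] at h2
      rw [update_ofNat_of_ne _ _ (by omega) (by omega) (by omega), h.mask a ha t ht, decide_eq_decide]
      omega

end Tables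

end BMH

/-! ### Preprocessing of the pattern -/

namespace BMH

open UWRAM

variable {w σ n m : ℕ}

/-- Strictness matters: advancing by one character then crosses at most one word boundary, so a
single conditional subtraction of w renormalizes the offset. -/
theorem Admissible.charBits_lt (h : Admissible w σ n m) : charBits σ < w := by
  have h1 := h.six_le
  have h2 : 2 ^ w = 2 * 2 ^ (w - 1) := by rw [← pow_succ']; congr 1; omega
  have h3 : charBits σ ≤ w - 1 := Nat.clog_le_of_le_pow (by have := h.bound; omega)
  omega

/-- With its companion for the carry case, this is the addition of (address, offset) pairs that
replaces division by w. -/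
theorem add_div_mod_of_lt {x y w : ℕ} (hw : 0 < w) (h : x % w + y % w < w) :
    x / w + y / w = (x + y) / w ∧ x % w + y % w = (x + y) % w := by
  rw [Nat.add_div hw, if_neg (by omega), Nat.add_mod_of_add_mod_lt h]
  simp

theorem add_div_mod_of_le {x y w : ℕ} (hw : 0 < w) (h : w ≤ x % w + y % w) :
    x / w + y / w + 1 = (x + y) / w ∧ x % w + y % w - w = (x + y) % w := by
  have := Nat.add_mod_add_of_le_add_mod h
  rw [Nat.add_div hw, if_pos h]
  omega

theorem ofNat_one_shiftLeft (k : ℕ) : BitVec.ofNat w 1 <<< k = BitVec.ofNat w (2 ^ k) := by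
  refine BitVec.eq_of_toNat_eq ?_
  rw [BitVec.toNat_shiftLeft, BitVec.toNat_ofNat, BitVec.toNat_ofNat, Nat.shiftLeft_eq,
    Nat.mod_mul_mod, one_mul]

/-- The registers `0, …, 12` hold the parameters and constants. -/
structure Params (σ n m : ℕ) (R : ℕ → BitVec w) : Prop where
  r0 : R 0 = BitVec.ofNat w n
  r1 : R 1 = BitVec.ofNat w m
  r3 : R 3 = BitVec.ofNat w (charBits σ)
  r4 : R 4 = BitVec.ofNat w w
  r5 : R 5 = BitVec.ofNat w (packedWords w σ n)
  r6 : R 6 = BitVec.ofNat w 1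
  r7 : R 7 = BitVec.ofNat w (n + m + σ)
  r8 : R 8 = BitVec.ofNat w (2 * (n + m + σ))
  r9 : R 9 = BitVec.ofNat w (3 * (n + m + σ))
  r10 : R 10 = BitVec.ofNat w (4 * (n + m + σ))
  r11 : R 11 = BitVec.ofNat w (2 ^ charBits σ - 1)
  r12 : R 12 = BitVec.allOnes w

theorem Params.update {R : ℕ → BitVec w} (h : Params σ n m R) {d : ℕ} {x : BitVec w} (hd : 12 < d) :
    Params σ n m (Function.update R d x) := by
  constructor <;> rw [Function.update_of_ne (by omega)]
  exacts [h.r0, h.r1, h.r3, h.r4, h.r5, h.r6, h.r7, h.r8, h.r9, h.r10, h.r11, h.r12]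

/-- In addition the registers `17, 18, 19` hold a position `i`, and the address and the offset of
the character `i` relative to the first one. -/
structure AtPosition (σ n m i : ℕ) (R : ℕ → BitVec w) : Prop extends Params σ n m R where
  r17 : R 17 = BitVec.ofNat w i
  r18 : R 18 = BitVec.ofNat w (i * charBits σ / w)
  r19 : R 19 = BitVec.ofNat w (i * charBits σ % w)

variable {R : ℕ → BitVec w} {W : ℕ → BitVec (w * w)} {M : BitVec w → BitVec w} {o : List (BitVec w)}
  {v : List (ℕ × List ℕ)} {b : ℕ} {Q : Config w → Prop} {T : Fin n → Fin σ} {P : Fin m → Fin σ}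

theorem AtPosition.update {i : ℕ} (h : AtPosition σ n m i R) {d : ℕ} {x : BitVec w} (hd : 19 < d) :
    AtPosition σ n m i (Function.update R d x) := by
  refine ⟨h.toParams.update (by omega), ?_, ?_, ?_⟩ <;> rw [Function.update_of_ne (by omega)]
  exacts [h.r17, h.r18, h.r19]

theorem leads_setup (hA : Admissible w σ n m)
    (h : ∀ R W M, AtPosition σ n m 0 R → Tables T P 0 0 0 0 M →
      Leads searchProgram 53 17 ⟨9, R, W, M, []⟩ v b Q) :
    Leads searchProgram 53 17 (init w T P) v (b + 9) Q := by
  have hw := hA.six_le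
  have hww := hA.word_le
  have hf := hA.charBits_lt
  have h0 : (init w T P).reg 0 = BitVec.ofNat w n := rfl
  have h1 : (init w T P).reg 1 = BitVec.ofNat w m := rfl
  have h2 : (init w T P).reg 2 = BitVec.ofNat w σ := rfl
  have h3 : (init w T P).reg 3 = BitVec.ofNat w (charBits σ) := rfl
  refine Leads.const rfl (by decide) ?_
  refine Leads.add rfl (by decide) h0 h1 ?_
  refine Leads.add rfl (by decide) rfl h2 ?_
  refine Leads.add rfl (by decide) rfl rfl ?_
  refine Leads.add rfl (by decide) rfl rfl ?_
  refine Leads.add rfl (by decide) rfl rfl ?_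
  refine Leads.shl rfl (by decide) rfl h3 (by omega) ?_
  refine Leads.sub rfl (by decide) (x := 2 ^ charBits σ)
    (ofNat_one_shiftLeft _) rfl (Nat.one_le_two_pow) ?_
  -- Register 22 has not been written yet, so its complement is the word of ones.
  refine Leads.not rfl (by decide) (x := 0) rfl ?_
  refine h _ _ _ ⟨⟨rfl, rfl, rfl, rfl, rfl, rfl, rfl, ?_, ?_, ?_, rfl, by simp⟩, rfl, ?_, ?_⟩
    (Tables.init hA)
  · exact congrArg (BitVec.ofNat w) (by ring)
  · exact congrArg (BitVec.ofNat w) (by ring)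
  · exact congrArg (BitVec.ofNat w) (by ring)
  · exact congrArg (BitVec.ofNat w) (by simp)
  · exact congrArg (BitVec.ofNat w) (by simp)

theorem leads_nextChar (hA : Admissible w σ n m) {j : ℕ} (hj : j < m) (hR : AtPosition σ n m j R)
    (hM : Tables T P (j + 1) (j + 1) (j + 1) (j * charBits σ / w * w) M)
    (h : ∀ R W M, AtPosition σ n m (j + 1) R →
      Tables T P (j + 1) (j + 1) (j + 1) ((j + 1) * charBits σ / w * w) M →
      Leads searchProgram 53 17 ⟨9, R, W, M, o⟩ v b Q) :
    Leads searchProgram 53 17 ⟨29, R, W, M, o⟩ v (b + 8) Q := by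
  have hw := hA.six_le
  have hww := hA.word_le
  have hf := hA.charBits_lt
  have hf1 := Nat.mod_eq_of_lt hf
  have hf2 := Nat.div_eq_of_lt hf
  have hr := Nat.mod_lt (j * charBits σ) (show 0 < w by omega)
  have hq := hA.mul_charBits_div_le j
  refine Leads.add rfl (by decide) hR.r17 hR.r6 ?_
  refine Leads.add rfl (by decide) hR.r19 hR.r3 ?_
  refine Leads.jumpLt rfl (by decide) rfl hR.r4 (by omega) (by omega) (fun hlt => ?_) fun hle => ?_
  · obtain ⟨h1, h2⟩ := add_div_mod_of_lt (x := j * charBits σ) (y := charBits σ) (w := w) (by omega)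
      (by omega)
    rw [hf1, ← Nat.succ_mul] at h2
    rw [hf2, ← Nat.succ_mul, add_zero] at h1
    refine (h _ _ _ ⟨(hR.toParams.update (by decide)).update (by decide), rfl, ?_, ?_⟩
      (h1 ▸ hM)).mono (by omega)
    · exact hR.r18.trans (by rw [h1])
    · exact congrArg (BitVec.ofNat w) h2
  · obtain ⟨h1, h2⟩ := add_div_mod_of_le (x := j * charBits σ) (y := charBits σ) (w := w) (by omega)
      (by omega)
    rw [hf1, ← Nat.succ_mul] at h2
    rw [hf2, ← Nat.succ_mul, add_zero] at h1
    refine Leads.add rfl (by decide) hR.r10 hR.r18 ?_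
    refine Leads.store rfl (by decide) rfl hR.r12 ?_
    refine Leads.sub rfl (by decide) rfl hR.r4 hle ?_
    refine Leads.add rfl (by decide) hR.r18 hR.r6 ?_
    refine Leads.jump rfl (by decide) ?_
    refine h _ _ _ ⟨(((((hR.toParams.update (by decide)).update (by decide)).update
      (by decide)).update (by decide)).update (by decide)), rfl, ?_, ?_⟩ ?_
    · exact congrArg (BitVec.ofNat w) h1
    · exact congrArg (BitVec.ofNat w) h2
    · rw [← h1, Nat.succ_mul]
      -- A mask word is filled with ones exactly when the scan leaves the corresponding pattern
      -- word.
      exact hM.store_mask hA (by omega) (by omega) (by omega) le_rfl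
        (fun t ht => by simp [ht])

theorem leads_tables (hA : Admissible w σ n m)
    (h : ∀ R W M, AtPosition σ n m m R →
      Tables T P m (m + 1) (m + 1) (m * charBits σ / w * w) M →
      Leads searchProgram 53 17 ⟨37, R, W, M, o⟩ v b Q) (d : ℕ) : ∀ (j : ℕ) R W M, j + d = m →
    AtPosition σ n m j R → Tables T P j j j (j * charBits σ / w * w) M →
    Leads searchProgram 53 17 ⟨9, R, W, M, o⟩ v (b + 6 + 28 * d) Q := by
  have hw := hA.six_le
  have hww := hA.word_le
  have hb := hA.bound
  have hf := hA.charBits_lt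
  induction d with
  | zero =>
    intro j R W M hj hR hM
    rw [add_zero] at hj
    subst hj
    refine Leads.add rfl (by decide) hR.r8 hR.r17 ?_
    refine Leads.store rfl (by decide) rfl hR.r18 ?_
    refine Leads.add rfl (by decide) hR.r9 hR.r17 ?_
    refine Leads.store rfl (by decide) rfl hR.r19 ?_
    refine Leads.sub rfl (by decide) hR.r1 hR.r17 le_rfl ?_
    refine Leads.jumpZero rfl (by decide) rfl (by omega) (fun _ => ?_) fun hne => by omega
    -- The address and offset tables include the entry m, since a shift can be as large as m.
    exact h _ _ _ (((hR.update (by decide)).update (by decide)).update (by decide))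
      ((hM.store_address hA le_rfl (by omega)).store_offset hA le_rfl le_rfl)
  | succ d ih =>
    intro j R W M hj hR hM
    have hq := hA.mul_charBits_div_le j
    have hp := hA.packedWords_le n
    have hr := Nat.mod_lt (j * charBits σ) (show 0 < w by omega)
    have hqr := Nat.div_add_mod' (j * charBits σ) w
    refine Leads.mono (b := b + 6 + 28 * d + 28) ?_ (by omega)
    refine Leads.add rfl (by decide) hR.r8 hR.r17 ?_
    refine Leads.store rfl (by decide) rfl hR.r18 ?_
    refine Leads.add rfl (by decide) hR.r9 hR.r17 ?_
    refine Leads.store rfl (by decide) rfl hR.r19 ?_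
    refine Leads.sub rfl (by decide) hR.r1 hR.r17 (by omega) ?_
    refine Leads.jumpZero rfl (by decide) rfl (by omega) (fun _ => by omega) fun _ => ?_
    have hM' := (hM.store_address hA (by omega) (by omega)).store_offset hA (by omega) (by omega)
    refine Leads.sub rfl (by decide) rfl hR.r6 (by omega) ?_
    refine Leads.jumpZero rfl (by decide) rfl (by omega) (fun h0 => ?_) fun h0 => ?_
    -- This is the last character of the pattern. It must not enter the table of last positions,
    -- because shifts only look at the first m - 1 characters.
    · refine (leads_nextChar hA (by omega) ((((hR.update (by decide)).update (by decide)).update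
        (by decide)).update (by decide)) ?_ (fun R W M hR hM => ih (j + 1) R W M (by omega) hR
          hM)).mono (by omega)
      exact ⟨hM'.text, hM'.pattern, fun c hc => (hM'.last c hc).trans
        (by rw [lastBefore_succ_of_last P (by omega)]), hM'.address, hM'.offset, hM'.mask⟩
    · refine Leads.add rfl (by decide) hR.r5 hR.r18 ?_
      refine Leads.load rfl (by decide) rfl rfl ?_
      refine Leads.shr rfl (by decide) rfl hR.r19 (by omega) ?_
      refine Leads.add rfl (by decide) rfl hR.r6 ?_
      refine Leads.load rfl (by decide) rfl rfl ?_
      refine Leads.sub rfl (by decide) hR.r4 hR.r19 (by omega) ?_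
      refine Leads.shl rfl (by decide) rfl rfl (by omega) ?_
      refine Leads.or rfl (by decide) rfl rfl ?_
      refine Leads.and rfl (by decide) rfl hR.r11
        (hM'.pattern.extract hf.le hr ⟨j, by omega⟩ hqr rfl) ?_
      refine Leads.add rfl (by decide) hR.r7 rfl ?_
      refine Leads.add rfl (by decide) hR.r17 hR.r6 ?_
      refine Leads.store rfl (by decide) rfl rfl ?_
      refine leads_nextChar hA (by omega) ?_ (hM'.store_last hA (by omega) (by omega) (by omega))
        (fun R W M hR hM => ih (j + 1) R W M (by omega) hR hM)
      repeat' first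
        | exact hR
        | refine AtPosition.update ?_ (by decide)

end BMH

/-! ### Comparing a window with the pattern by wide words -/

namespace UWRAM

theorem getLsbD_ofBlocks {w : ℕ} (g : ℕ → BitVec w) {k : ℕ} (hk : k < w * w) :
    (ofBlocks g).getLsbD k = (g (k / w)).getLsbD (k % w) := by
  simp [ofBlocks, hk]

end UWRAM

namespace BMH

open UWRAM

variable {w σ n m : ℕ}

/-- The first `b` bits of the packed pattern agree with those of the window at `i`. -/
def BitsAgree (T : Fin n → Fin σ) (P : Fin m → Fin σ) (i b : ℕ) : Prop :=
  ∀ t < b, t < m * charBits σ →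
    packedBit (charBits σ) T (i * charBits σ + t) = packedBit (charBits σ) P t

/-- The first `k` characters of the pattern agree with those of the window at `i`. -/
def CharsAgree (T : Fin n → Fin σ) (P : Fin m → Fin σ) (i k : ℕ) : Prop :=
  ∃ h : i + m ≤ n, ∀ j : Fin m, (j : ℕ) < k → T ⟨i + j, by omega⟩ = P j

instance (T : Fin n → Fin σ) (P : Fin m → Fin σ) (i k : ℕ) : Decidable (CharsAgree T P i k) := by
  unfold CharsAgree; infer_instance

variable {T : Fin n → Fin σ} {P : Fin m → Fin σ} {i : ℕ}

theorem packedBit_window (hi : i + m ≤ n) (j : Fin m) {t : ℕ} (ht : t < charBits σ) :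
    packedBit (charBits σ) T (i * charBits σ + (j * charBits σ + t)) =
      (T ⟨i + j, by omega⟩ : ℕ).testBit t := by
  rw [← packedBit_mul_add T ⟨i + j, by omega⟩ ht, ← add_assoc, ← Nat.add_mul]

theorem BitsAgree.charsAgree {b k : ℕ} (h : BitsAgree T P i b) (hi : i + m ≤ n)
    (hk : k * charBits σ ≤ b) : CharsAgree T P i k := by
  refine ⟨hi, fun j hj => Fin.ext (Nat.eq_of_testBit_eq fun t => ?_)⟩
  by_cases ht : t < charBits σ
  · have h1 : (j + 1) * charBits σ ≤ k * charBits σ := Nat.mul_le_mul_right _ hj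
    have h2 : (j + 1) * charBits σ ≤ m * charBits σ := Nat.mul_le_mul_right _ j.2
    rw [Nat.succ_mul] at h1 h2
    rw [← packedBit_window hi j ht, h _ (by omega) (by omega), packedBit_mul_add P j ht]
  -- Bits from `charBits σ` on vanish for every character, as σ ≤ 2 ^ `charBits σ`.
  · have h1 : ∀ x : Fin σ, (x : ℕ).testBit t = false := fun x =>
      Nat.testBit_lt_two_pow (x.2.trans_le ((Admissible.le_pow_charBits σ).trans
        (Nat.pow_le_pow_right (by norm_num) (not_lt.mp ht))))
    rw [h1, h1]

theorem BitsAgree.occursAt {b : ℕ} (h : BitsAgree T P i b) (hi : i + m ≤ n)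
    (hb : m * charBits σ ≤ b) : OccursAt T P i :=
  ⟨hi, fun j => (h.charsAgree hi hb).2 j j.2⟩

theorem OccursAt.bitsAgree (h : OccursAt T P i) (b : ℕ) : BitsAgree T P i b := by
  intro t _ ht
  obtain ⟨hi, h⟩ := h
  have hf : 0 < charBits σ := Nat.pos_of_ne_zero fun h0 => by simp [h0] at ht
  have h1 : t / charBits σ < m := (Nat.div_lt_iff_lt_mul hf).mpr ht
  have h2 := packedBit_window (T := T) hi ⟨t / charBits σ, h1⟩ (Nat.mod_lt t hf)
  have h3 := packedBit_mul_add P ⟨t / charBits σ, h1⟩ (Nat.mod_lt t hf)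
  rw [h ⟨t / charBits σ, h1⟩, ← h3] at h2
  simpa only [Nat.div_add_mod'] using h2

/-- Shifting the text right by r < w leaves w * w - r correct bits, so all but the top block are
reliable for every r. Shifting the mask left and then right by w clears its top block; the remaining
ones end with the pattern. Whatever the reads fetch beyond text or pattern is therefore masked out.
-/
theorem compare_eq_zero_iff (hA : Admissible w σ n m) {j jq jr : ℕ} {M : BitVec w → BitVec w}
    (hM : Tables T P j jq jr (m * charBits σ) M) (hi : i + m ≤ n) {k : ℕ} (hk : k ≤ m)
    {X Y Z : BitVec (w * w)}
    (hX : X = ofBlocks fun a => M (BitVec.ofNat w (i * charBits σ / w + k + a)))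
    (hY : Y = ofBlocks fun a => M (BitVec.ofNat w (packedWords w σ n + k + a)))
    (hZ : Z = ofBlocks fun a => M (BitVec.ofNat w (4 * (n + m + σ) + k + a))) :
    (X >>> (i * charBits σ % w) &&& (Z <<< w) >>> w) - (Y &&& (Z <<< w) >>> w) = 0 ↔
      ∀ t, t + w < w * w → k * w + t < m * charBits σ →
        packedBit (charBits σ) T (i * charBits σ + (k * w + t)) =
          packedBit (charBits σ) P (k * w + t) := by
  have hw := hA.six_le
  set r := i * charBits σ % w with hr
  set q := i * charBits σ / w with hq
  have hrw : r < w := Nat.mod_lt _ (by omega)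
  have hqr : q * w + r = i * charBits σ := Nat.div_add_mod' _ _
  have hmul : i * charBits σ + m * charBits σ ≤ n * charBits σ := by
    rw [← Nat.add_mul]; exact Nat.mul_le_mul_right _ hi
  have hZt : ∀ t, t < w * w → ((Z <<< w) >>> w).getLsbD t =
      (decide (t + w < w * w) && decide (k * w + t < m * charBits σ)) := by
    intro t ht
    have h1 : t / w < w := (Nat.div_lt_iff_lt_mul (by omega)).mpr ht
    rw [BitVec.getLsbD_ushiftRight, BitVec.getLsbD_shiftLeft, hZ, Nat.add_sub_cancel_left,
      getLsbD_ofBlocks _ ht, add_assoc, hM.mask _ (by omega) _ (Nat.mod_lt _ (by omega)),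
      Nat.add_mul, add_assoc, Nat.div_add_mod', add_comm w t]
    simp
  have hXt : ∀ t, t + w < w * w → k * w + t < m * charBits σ → (X >>> r).getLsbD t =
      packedBit (charBits σ) T (i * charBits σ + (k * w + t)) := by
    intro t ht htm
    have h1 : (q + k + (r + t) / w) * w + (r + t) % w = i * charBits σ + (k * w + t) := by
      rw [Nat.add_mul, Nat.add_mul, add_assoc, Nat.div_add_mod', ← hqr]; ring
    have h2 := hM.text (q + k + (r + t) / w) ((r + t) % w) (Nat.mod_lt _ (by omega))
      (by rw [h1]; omega)
    rw [h1, zero_add] at h2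
    rw [BitVec.getLsbD_ushiftRight, hX, getLsbD_ofBlocks _ (by omega), h2]
  have hYt : ∀ t, t + w < w * w → k * w + t < m * charBits σ → Y.getLsbD t =
      packedBit (charBits σ) P (k * w + t) := by
    intro t ht htm
    have h1 : (k + t / w) * w + t % w = k * w + t := by
      rw [Nat.add_mul, add_assoc, Nat.div_add_mod']
    have h2 := hM.pattern (k + t / w) (t % w) (Nat.mod_lt _ (by omega)) (by rw [h1]; omega)
    rw [h1, ← add_assoc] at h2
    rw [hY, getLsbD_ofBlocks _ (by omega), h2]
  rw [BitVec.sub_eq_iff_eq_add, zero_add]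
  constructor
  · intro h t ht htm
    have h1 := congrArg (fun x => BitVec.getLsbD x t) h
    simp only [BitVec.getLsbD_and, hZt t (by omega), ht, htm, decide_true, Bool.and_true] at h1
    rw [← hXt t ht htm, h1, hYt t ht htm]
  · intro h
    refine BitVec.eq_of_getLsbD_eq fun t ht => ?_
    rw [BitVec.getLsbD_and, BitVec.getLsbD_and, hZt t ht]
    by_cases h1 : t + w < w * w
    · by_cases h2 : k * w + t < m * charBits σ
      · rw [hXt t h1 h2, hYt t h1 h2, h t h1 h2]
      · simp [h2]
    · simp [h1]

/-- The number of chunks of `w - 1` words in which the pattern is compared. -/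
def chunks (w σ m : ℕ) : ℕ := m * charBits σ / w / (w - 1) + 1

/-- In addition the registers `13, …, 16` hold the number of mask words, `w - 1`, and the address
and the offset of the last character in a window. -/
structure AtWindow (σ n m i : ℕ) (R : ℕ → BitVec w) : Prop extends AtPosition σ n m i R where
  r13 : R 13 = BitVec.ofNat w (m * charBits σ / w + 1)
  r14 : R 14 = BitVec.ofNat w (w - 1)
  r15 : R 15 = BitVec.ofNat w ((m - 1) * charBits σ / w)
  r16 : R 16 = BitVec.ofNat w ((m - 1) * charBits σ % w)

variable {R : ℕ → BitVec w} {W : ℕ → BitVec (w * w)} {M : BitVec w → BitVec w} {o : List (BitVec w)}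
  {v : List (ℕ × List ℕ)} {b : ℕ} {Q : Config w → Prop}

theorem AtWindow.update (h : AtWindow σ n m i R) {d : ℕ} {x : BitVec w} (hd : 19 < d) :
    AtWindow σ n m i (Function.update R d x) := by
  refine ⟨h.toAtPosition.update hd, ?_, ?_, ?_, ?_⟩ <;> rw [Function.update_of_ne (by omega)]
  exacts [h.r13, h.r14, h.r15, h.r16]

/-- Induction on the number of remaining chunks, with agreement of all earlier chunks as invariant.
A chunk costs at most 15 steps, charged to its index k, which counts because k earlier agreeing
chunks force `CharsAgree T P i k`. -/
theorem leads_compare (hA : Admissible w σ n m) {j jq jr : ℕ}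
    (hM : Tables T P j jq jr (m * charBits σ) M) (hi : i + m ≤ n)
    (h : OccursAt T P i → ∀ R W, AtWindow σ n m i R →
      Leads searchProgram 53 17 ⟨70, R, W, M, o⟩ v b Q)
    (h' : ¬ OccursAt T P i → ∀ R W, AtWindow σ n m i R →
      Leads searchProgram 53 17 ⟨72, R, W, M, o⟩ v b Q) (d : ℕ) :
    ∀ k R W, k + d + 1 = chunks w σ m → AtWindow σ n m i R →
      R 21 = BitVec.ofNat w (k * (w - 1)) → BitsAgree T P i (k * (w - 1) * w) →
      Leads searchProgram 53 17 ⟨54, R, W, M, o⟩ v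
        (b + 15 * ((Finset.Ico k (chunks w σ m)).filter (CharsAgree T P i)).card) Q := by
  have hw := hA.six_le
  have hww := hA.word_le
  have hb := hA.bound
  have hf := hA.charBits_lt
  have hqm := hA.mul_charBits_div_le m
  -- The loop test of the program, in words of the mask, expressed as a bound on the chunk index.
  have hlt : ∀ k, k < chunks w σ m ↔ k * (w - 1) < m * charBits σ / w + 1 := by
    intro k
    rw [chunks, Nat.lt_succ_iff, Nat.lt_succ_iff, Nat.le_div_iff_mul_le (by omega)]
  induction d with
  | zero => ?_
  | succ d ih => ?_
  all_goals
    intro k R W hk hR h21 hB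
    have hkm := (hlt k).mp (by omega)
    -- A chunk has (w - 1) * w ≥ w bits, hence at least one whole character's worth. This crude
    -- count already gives a geometric series in the mean.
    have hC : CharsAgree T P i k := hB.charsAgree hi (by
      rw [mul_assoc]
      refine Nat.mul_le_mul_left _ (hf.le.trans ?_)
      exact Nat.le_mul_of_pos_left _ (by omega))
    rw [Finset.Ico_eq_cons_Ioo (by omega), Finset.filter_cons_of_pos _ _ _ _ hC, Finset.card_cons]
    have hI : Finset.Ioo k (chunks w σ m) = Finset.Ico (k + 1) (chunks w σ m) := by
      ext; simp
    rw [hI]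
    have hstep : (k + 1) * (w - 1) = k * (w - 1) + (w - 1) := Nat.succ_mul _ _
    have hzero := compare_eq_zero_iff hA hM hi (k := k * (w - 1)) (by omega) rfl rfl rfl
    rw [mul_add, mul_one, ← add_assoc]
    refine Leads.add rfl (by decide) hR.r18 h21 ?_
    refine Leads.readWord rfl (by decide) rfl ?_
    refine Leads.wideShr rfl (by decide) rfl hR.r19
      ((Nat.mod_lt _ (by omega)).trans_le (by omega)) ?_
    refine Leads.add rfl (by decide) hR.r5 h21 ?_
    refine Leads.readWord rfl (by decide) rfl ?_
    refine Leads.add rfl (by decide) hR.r10 h21 ?_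
    refine Leads.readWord rfl (by decide) rfl ?_
    refine Leads.wideShl rfl (by decide) rfl hR.r4 (by omega) ?_
    refine Leads.wideShr rfl (by decide) rfl hR.r4 (by omega) ?_
    refine Leads.wideAnd rfl (by decide) rfl rfl ?_
    refine Leads.wideAnd rfl (by decide) rfl rfl ?_
    refine Leads.wideSub rfl (by decide) rfl rfl ?_
    have hR' := fun x y z => ((hR.update (d := 22) (x := x) (by decide)).update (d := 23) (x := y)
      (by decide)).update (d := 24) (x := z) (by decide)
    refine Leads.wideJumpZero rfl (by decide) rfl (fun h0 => ?_) fun h0 => ?_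
    · have hB' : BitsAgree T P i ((k + 1) * (w - 1) * w) := by
        intro t ht htm
        by_cases h1 : t < k * (w - 1) * w
        · exact hB t h1 htm
        · have h2 : (k * (w - 1) + (w - 1)) * w = k * (w - 1) * w + (w * w - w) := by
            rw [Nat.add_mul, Nat.sub_mul, one_mul]
          rw [hstep, h2] at ht
          obtain ⟨s, rfl⟩ := Nat.exists_eq_add_of_le (not_lt.mp h1)
          exact hzero.mp h0 s (by omega) htm
      refine Leads.add rfl (by decide) h21 hR.r14 ?_
      refine Leads.jumpLt rfl (by decide) rfl hR.r13 (by omega) (by omega) (fun h1 => ?_)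
        fun h1 => ?_
      all_goals rw [← hstep] at h1
      -- In the base case k is the last chunk and the loop cannot continue; otherwise the induction
      -- hypothesis applies to k + 1.
      · first
        | exact absurd ((hlt _).mpr h1) (by omega)
        | refine ih (k + 1) _ _ (by omega) ?_ ?_ hB'
          · exact (hR' _ _ _).update (by decide)
          · exact congrArg (BitVec.ofNat w) hstep.symm
      · refine (h (hB'.occursAt hi ?_) _ _ ((hR' _ _ _).update (by decide))).mono (by omega)
        -- The chunks compared so far cover all mask words, hence all m * f bits of the pattern.
        have h2 : (m * charBits σ / w + 1) * w ≤ (k + 1) * (w - 1) * w := Nat.mul_le_mul_right _ h1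
        have h3 := Nat.div_add_mod' (m * charBits σ) w
        have h4 := Nat.mod_lt (m * charBits σ) (show 0 < w by omega)
        rw [Nat.succ_mul] at h2
        omega
    · refine Leads.jump rfl (by decide) ?_
      refine (h' (fun hocc => h0 (hzero.mpr fun t _ htm => ?_)) _ _ (hR' _ _ _)).mono (by omega)
      exact hocc.bitsAgree _ _ (Nat.lt_succ_self _) htm

end BMH

/-! ### The search loop: correctness of the shifts and total running time -/

namespace BMH

open UWRAM

variable {w σ n m : ℕ} {T : Fin n → Fin σ} {P : Fin m → Fin σ} {i : ℕ}

theorem shift_le (P : Fin m → Fin σ) (a : Fin σ) : shift P a ≤ m := Nat.sub_le _ _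

/-- An occurrence at i' would align the last character of the window at i with the pattern index i +
m - 1 - i' < m - 1. This bounds the shift by i' - i. -/
theorem not_occursAt_of_lt_shift (hi : i + m ≤ n) (hm : 0 < m) {i' : ℕ} (h1 : i < i')
    (h2 : i' < i + shift P (T ⟨i + m - 1, by omega⟩)) : ¬ OccursAt T P i' := by
  rintro ⟨hi', h⟩
  have hs := shift_le P (T ⟨i + m - 1, by omega⟩)
  have h3 := h ⟨i + m - 1 - i', by omega⟩
  have h4 : i + m - 1 - i' + 1 ≤ (Finset.univ.filter fun j : Fin m =>
      (j : ℕ) + 1 < m ∧ P j = T ⟨i + m - 1, by omega⟩).sup fun j => (j : ℕ) + 1 := by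
    refine Finset.le_sup (f := fun j : Fin m => (j : ℕ) + 1) (b := ⟨i + m - 1 - i', by omega⟩)
      (Finset.mem_filter.mpr ⟨Finset.mem_univ _, by simp only; omega, ?_⟩)
    rw [← h3]
    congr 2
    simp only
    omega
  unfold shift at h2
  omega

theorem occurrencesBefore_succ (k : ℕ) : occurrencesBefore T P (k + 1) =
    occurrencesBefore T P k ++ if OccursAt T P k then [k + 1] else [] := by
  unfold occurrencesBefore
  rw [List.range_succ, List.filter_append, List.map_append]
  congr 1
  split_ifs with h <;> simp [h]

theorem occurrencesBefore_eq_of_forall {k : ℕ} (d : ℕ)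
    (h : ∀ i, k ≤ i → i < k + d → ¬ OccursAt T P i) :
    occurrencesBefore T P (k + d) = occurrencesBefore T P k := by
  induction d with
  | zero => rfl
  | succ d ih =>
    rw [← add_assoc, occurrencesBefore_succ, if_neg (h _ (by omega) (by omega)), List.append_nil,
      ih fun i h1 h2 => h i h1 (by omega)]

theorem occurrencesBefore_add_shift (hi : i + m ≤ n) (hm : 0 < m) :
    occurrencesBefore T P (i + shift P (T ⟨i + m - 1, by omega⟩)) =
      occurrencesBefore T P i ++ if OccursAt T P i then [i + 1] else [] := by
  have hs := shift_pos P (T ⟨i + m - 1, by omega⟩) hm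
  have h2 : i + shift P (T ⟨i + m - 1, by omega⟩) =
    i + 1 + (shift P (T ⟨i + m - 1, by omega⟩) - 1) := by omega
  rw [h2, occurrencesBefore_eq_of_forall, occurrencesBefore_succ]
  exact fun i' h1 h3 => not_occursAt_of_lt_shift hi hm (by omega) (by omega)

theorem occurrencesBefore_of_lt (hi : n < i + m) (hin : i ≤ n + 1) :
    occurrencesBefore T P i = occurrences T P := by
  unfold occurrences
  obtain ⟨d, hd⟩ := Nat.exists_eq_add_of_le hin
  rw [hd, occurrencesBefore_eq_of_forall]
  rintro i' h1 _ ⟨h2, _⟩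
  omega

variable {R : ℕ → BitVec w} {W : ℕ → BitVec (w * w)} {M : BitVec w → BitVec w} {o : List (BitVec w)}
  {v : List (ℕ × List ℕ)} {b : ℕ} {Q : Config w → Prop}

theorem leads_searchSetup (hA : Admissible w σ n m) (hR : AtPosition σ n m m R)
    (hM : Tables T P m (m + 1) (m + 1) (m * charBits σ / w * w) M)
    (h : ∀ R W M, AtWindow σ n m 0 R → Tables T P m (m + 1) (m + 1) (m * charBits σ) M →
      Leads searchProgram 53 17 ⟨51, R, W, M, o⟩ v b Q) :
    Leads searchProgram 53 17 ⟨37, R, W, M, o⟩ v (b + 14) Q := by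
  have hw := hA.six_le
  have hww := hA.word_le
  have hm := hA.pos
  have hr := Nat.mod_lt (m * charBits σ) (show 0 < w by omega)
  have hM' := hM.store_mask hA le_rfl le_rfl (hA.mul_charBits_div_le m) hr.le
    (v := BitVec.ofNat w (2 ^ (m * charBits σ % w) - 1))
    (fun t ht => by rw [BitVec.getLsbD_ofNat, Nat.testBit_two_pow_sub_one]; simp [ht])
  rw [Nat.div_add_mod'] at hM'
  refine Leads.shl rfl (by decide) hR.r6 hR.r19 (by omega) ?_
  refine Leads.sub rfl (by decide) (ofNat_one_shiftLeft _) hR.r6 Nat.one_le_two_pow ?_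
  refine Leads.add rfl (by decide) hR.r10 hR.r18 ?_
  refine Leads.store rfl (by decide) rfl rfl ?_
  refine Leads.add rfl (by decide) hR.r18 hR.r6 ?_
  refine Leads.sub rfl (by decide) hR.r4 hR.r6 (by omega) ?_
  refine Leads.sub rfl (by decide) hR.r1 hR.r6 (by omega) ?_
  refine Leads.add rfl (by decide) hR.r8 rfl ?_
  refine Leads.load rfl (by decide) rfl (hM'.address (m - 1) (by omega)) ?_
  refine Leads.add rfl (by decide) hR.r9 rfl ?_
  refine Leads.load rfl (by decide) rfl (hM'.offset (m - 1) (by omega)) ?_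
  refine Leads.const rfl (by decide) ?_
  refine Leads.const rfl (by decide) ?_
  refine Leads.const rfl (by decide) ?_
  refine h _ _ _ ⟨⟨?_, rfl, ?_, ?_⟩, rfl, rfl, rfl, rfl⟩ hM'
  · repeat' first
      | exact hR.toParams
      | refine Params.update ?_ (by decide)
  · exact congrArg (BitVec.ofNat w) (by simp)
  · exact congrArg (BitVec.ofNat w) (by simp)

/-- Registers 26 and 27 locate the last character of the window. It selects the shift, whose
tabulated pair is added to the pair of the window; both offsets are below w, so one carry at most
occurs. -/
theorem leads_shift (hA : Admissible w σ n m) (hR : AtWindow σ n m i R)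
    (hM : Tables T P m (m + 1) (m + 1) (m * charBits σ) M) (hi : i + m ≤ n) {q r : ℕ}
    (h26 : R 26 = BitVec.ofNat w q) (h27 : R 27 = BitVec.ofNat w r) (hr : r < w)
    (hqr : q * w + r = (i + m - 1) * charBits σ)
    (h : ∀ R W, AtWindow σ n m (i + shift P (T ⟨i + m - 1, by have := hA.pos; omega⟩)) R →
      Leads searchProgram 53 17 ⟨51, R, W, M, o⟩ v b Q) :
    Leads searchProgram 53 17 ⟨77, R, W, M, o⟩ v (b + 22) Q := by
  have hw := hA.six_le
  have hww := hA.word_le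
  have hf := hA.charBits_lt
  have hm := hA.pos
  set a := T ⟨i + m - 1, by omega⟩ with ha
  have hsm := shift_le P a
  have hl := sub_lastBefore P a
  have hr1 := Nat.mod_lt (i * charBits σ) (show 0 < w by omega)
  have hr2 := Nat.mod_lt (shift P a * charBits σ) (show 0 < w by omega)
  refine Leads.load rfl (by decide) h26 rfl ?_
  refine Leads.shr rfl (by decide) rfl h27 (by omega) ?_
  refine Leads.add rfl (by decide) h26 hR.r6 ?_
  refine Leads.load rfl (by decide) rfl rfl ?_
  refine Leads.sub rfl (by decide) hR.r4 h27 (by omega) ?_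
  refine Leads.shl rfl (by decide) rfl rfl (by omega) ?_
  refine Leads.or rfl (by decide) rfl rfl ?_
  refine Leads.and rfl (by decide) rfl hR.r11
    (hM.text.extract hf.le hr ⟨i + m - 1, by omega⟩ hqr (zero_add q).symm) ?_
  refine Leads.add rfl (by decide) hR.r7 rfl ?_
  refine Leads.load rfl (by decide) rfl (hM.last a a.2) ?_
  refine Leads.sub rfl (by decide) hR.r1 rfl (lastBefore_le _ _ _) ?_
  rw [hl]
  refine Leads.add rfl (by decide) hR.r17 rfl ?_
  refine Leads.add rfl (by decide) hR.r8 rfl ?_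
  refine Leads.load rfl (by decide) rfl (hM.address _ (by omega)) ?_
  refine Leads.add rfl (by decide) hR.r18 rfl ?_
  refine Leads.add rfl (by decide) hR.r9 rfl ?_
  refine Leads.load rfl (by decide) rfl (hM.offset _ (by omega)) ?_
  refine Leads.add rfl (by decide) hR.r19 rfl ?_
  refine Leads.jumpLt rfl (by decide) rfl hR.r4 (by omega) (by omega) (fun hlt => ?_) fun hle => ?_
  · obtain ⟨h1, h2⟩ := add_div_mod_of_lt (by omega) hlt
    rw [← Nat.add_mul] at h1 h2
    refine Leads.mono (h _ _ ⟨⟨?_, rfl, ?_, ?_⟩, hR.r13, hR.r14, hR.r15, hR.r16⟩) (by omega)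
    · repeat' first
        | exact hR.toParams
        | refine Params.update ?_ (by decide)
    · exact congrArg (BitVec.ofNat w) h1
    · exact congrArg (BitVec.ofNat w) h2
  · obtain ⟨h1, h2⟩ := add_div_mod_of_le (by omega) hle
    rw [← Nat.add_mul] at h1 h2
    refine Leads.sub rfl (by decide) rfl hR.r4 hle ?_
    refine Leads.add rfl (by decide) rfl hR.r6 ?_
    refine Leads.jump rfl (by decide) ?_
    refine h _ _ ⟨⟨?_, rfl, ?_, ?_⟩, hR.r13, hR.r14, hR.r15, hR.r16⟩
    · repeat' first
        | exact hR.toParams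
        | refine Params.update ?_ (by decide)
    · exact congrArg (BitVec.ofNat w) h1
    · exact congrArg (BitVec.ofNat w) h2

theorem leads_advance (hA : Admissible w σ n m) (hR : AtWindow σ n m i R)
    (hM : Tables T P m (m + 1) (m + 1) (m * charBits σ) M) (hi : i + m ≤ n)
    (h : ∀ R W, AtWindow σ n m (i + shift P (T ⟨i + m - 1, by have := hA.pos; omega⟩)) R →
      Leads searchProgram 53 17 ⟨51, R, W, M, o⟩ v b Q) :
    Leads searchProgram 53 17 ⟨72, R, W, M, o⟩ v (b + 27) Q := by
  have hw := hA.six_le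
  have hww := hA.word_le
  have hm := hA.pos
  have hr1 := Nat.mod_lt (i * charBits σ) (show 0 < w by omega)
  have hr2 := Nat.mod_lt ((m - 1) * charBits σ) (show 0 < w by omega)
  have hi1 : i * charBits σ + (m - 1) * charBits σ = (i + m - 1) * charBits σ := by
    rw [← Nat.add_mul, Nat.add_sub_assoc hm]
  have hd := Nat.div_add_mod' ((i + m - 1) * charBits σ) w
  have hr := Nat.mod_lt ((i + m - 1) * charBits σ) (show 0 < w by omega)
  refine Leads.add rfl (by decide) hR.r18 hR.r15 ?_
  refine Leads.add rfl (by decide) hR.r19 hR.r16 ?_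
  refine Leads.jumpLt rfl (by decide) rfl hR.r4 (by omega) (by omega) (fun hlt => ?_) fun hle => ?_
  · obtain ⟨h1, h2⟩ := add_div_mod_of_lt (by omega) hlt
    rw [hi1] at h1 h2
    exact Leads.mono (leads_shift hA ((hR.update (by decide)).update (by decide)) hM hi
      (congrArg (BitVec.ofNat w) h1) (congrArg (BitVec.ofNat w) h2) hr hd h) (by omega)
  · obtain ⟨h1, h2⟩ := add_div_mod_of_le (by omega) hle
    rw [hi1] at h1 h2
    refine Leads.sub rfl (by decide) rfl hR.r4 hle ?_
    refine Leads.add rfl (by decide) rfl hR.r6 ?_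
    refine leads_shift hA ?_ hM hi (congrArg (BitVec.ofNat w) h1) (congrArg (BitVec.ofNat w) h2) hr
      hd h
    exact (((hR.update (by decide)).update (by decide)).update (by decide)).update (by decide)

/-- The number of chunks that are compared at the window `i`. -/
def chunksCompared (w : ℕ) (T : Fin n → Fin σ) (P : Fin m → Fin σ) (i : ℕ) : ℕ :=
  ((Finset.range (chunks w σ m)).filter (CharsAgree T P i)).card

/-- The budget of a window is 32 steps plus the chunk comparisons. Summing over all positions from i
on, instead of only over the windows, makes the bound independent of which windows the text
produces. -/
theorem leads_windows (hA : Admissible w σ n m)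
    (hM : Tables T P m (m + 1) (m + 1) (m * charBits σ) M) (d : ℕ) : ∀ i R W o, n + 1 - i ≤ d →
    i ≤ n → AtWindow σ n m i R → o.map BitVec.toNat = occurrencesBefore T P i →
    Leads searchProgram 53 17 ⟨51, R, W, M, o⟩
      ((windowsFrom T P i).map fun i => (i, occurrencesBefore T P i))
      (2 + ∑ k ∈ Finset.Ico i (n + 1), (32 + 15 * chunksCompared w T P k))
      fun c => c.pc = 99 ∧ c.out.map BitVec.toNat = occurrences T P := by
  have hw := hA.six_le
  have hww := hA.word_le
  have hb := hA.bound
  have hm := hA.pos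
  induction d with
  | zero => intro i _ _ _ h1 h2; omega
  | succ d ih =>
    intro i R W o hd hin hR ho
    refine Leads.mono (b := (∑ k ∈ Finset.Ico i (n + 1), (32 + 15 * chunksCompared w T P k)) + 2) ?_
      (by omega)
    refine Leads.add rfl (by decide) hR.r17 hR.r1 ?_
    refine Leads.jumpLt rfl (by decide) hR.r0 rfl (by omega) (by omega) (fun hlt => ?_) fun hle => ?_
    · rw [windowsFrom, dif_neg (by omega)]
      -- The bound test precedes instruction 53, so leaving the text adds nothing to the recorded
      -- windows.
      exact Leads.done ⟨rfl, ho.trans (occurrencesBefore_of_lt hlt (by omega))⟩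
    · set a := T ⟨i + m - 1, by omega⟩ with ha
      have hs := shift_pos P a hm
      have hsm := shift_le P a
      have hocc := occurrencesBefore_add_shift (T := T) (P := P) hle hm
      rw [← ha] at hocc
      rw [windowsFrom, dif_pos ⟨hm, hle⟩, List.map_cons]
      have hobs : (i, occurrencesBefore T P i) = Config.observe 17
          (⟨53, Function.update R 20 (BitVec.ofNat w (i + m)), W, M, o⟩ : Config w) := by
        refine Prod.ext ?_ ho.symm
        show i = (R 17).toNat
        rw [hR.r17, BitVec.toNat_ofNat, Nat.mod_eq_of_lt (by omega)]
      -- The terms of the skipped positions are dropped; only the term of i is spent.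
      have hsum : 2 + ∑ k ∈ Finset.Ico (i + shift P a) (n + 1), (32 + 15 * chunksCompared w T P k) +
          (32 + 15 * chunksCompared w T P i) ≤
          ∑ k ∈ Finset.Ico i (n + 1), (32 + 15 * chunksCompared w T P k) + 2 := by
        rw [Finset.sum_eq_sum_Ico_succ_bot (show i < n + 1 by omega)]
        have := Finset.sum_le_sum_of_subset (f := fun k => 32 + 15 * chunksCompared w T P k)
          (Finset.Ico_subset_Ico_left (b := n + 1) (show i + 1 ≤ i + shift P a by omega))
        omega
      rw [hobs]
      refine Leads.mono (b := 2 + ∑ k ∈ Finset.Ico (i + shift P a) (n + 1),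
        (32 + 15 * chunksCompared w T P k) + 29 + 15 * chunksCompared w T P i + 1) ?_ (by omega)
      refine Leads.cons_visit (c' := ⟨54, Function.update (Function.update R 20
        (BitVec.ofNat w (i + m))) 21 (BitVec.ofNat w 0), W, M, o⟩) rfl rfl ?_
      rw [chunksCompared, Finset.range_eq_Ico]
      refine leads_compare hA hM hle (fun h R W hR => ?_) (fun h R W hR => ?_) (chunks w σ m - 1) 0
        _ _ ?_ ?_ ?_ ?_
      · refine Leads.add rfl (by decide) hR.r17 hR.r6 ?_
        refine Leads.report rfl (by decide) rfl ?_
        refine leads_advance hA (hR.update (by decide)) hM hle fun R W hR => ?_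
        rw [← ha] at hR
        refine ih (i + shift P a) _ _ _ (by omega) (by omega) hR ?_
        rw [hocc, if_pos h, List.map_append, ho]
        simp [Nat.mod_eq_of_lt (show i + 1 < 2 ^ w by omega)]
      · refine Leads.mono (leads_advance hA hR hM hle fun R W hR => ?_) (Nat.add_le_add_left (by decide : 27 ≤ 29) _)
        rw [← ha] at hR
        refine ih (i + shift P a) _ _ _ (by omega) (by omega) hR ?_
        rw [hocc, if_neg h, List.append_nil, ho]
      · have : 0 < chunks w σ m := Nat.succ_pos _
        omega
      · exact (hR.update (by decide)).update (by decide)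
      · exact congrArg (BitVec.ofNat w) (by simp)
      · intro t ht
        simp at ht

theorem exists_runsIn (hA : Admissible w σ n m) (T : Fin n → Fin σ) (P : Fin m → Fin σ) :
    ∃ t, RunsIn searchProgram 53 17 w T P t ∧
      t ≤ 31 + 28 * m + ∑ k ∈ Finset.range (n + 1), (32 + 15 * chunksCompared w T P k) := by
  have h : Leads searchProgram 53 17 (init w T P)
      ((windowsFrom T P 0).map fun i => (i, occurrencesBefore T P i))
      (2 + ∑ k ∈ Finset.Ico 0 (n + 1), (32 + 15 * chunksCompared w T P k) + 14 + 6 + 28 * m + 9)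
      fun c => c.pc = 99 ∧ c.out.map BitVec.toNat = occurrences T P := by
    refine leads_setup hA fun R W M hR hM => ?_
    refine leads_tables hA (fun R W M hR hM => ?_) m 0 _ _ _ (by omega) hR (by simpa using hM)
    refine leads_searchSetup hA hR hM fun R W M hR hM => ?_
    exact leads_windows hA hM (n + 1) 0 _ _ _ (by omega) (by omega) hR rfl
  obtain ⟨t, c, ht, h1, h2, h3, h4⟩ := h
  refine ⟨t, ⟨⟨c, ?_, ?_, h4⟩, ?_⟩, ?_⟩
  · simpa [run] using h1 0
  · rw [Halted, h3]; rfl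
  · have := h2 0
    -- The final configuration stands at instruction 99, not 53, so it adds no visit.
    rw [zero_add, visits, if_neg (by rw [h3]; decide), List.map_nil, List.append_nil] at this
    exact this
  · rw [Finset.range_eq_Ico]; omega

end BMH

/-! ### Counting chunk comparisons in the worst case and on average -/

namespace BMH

open UWRAM

variable {w σ n m : ℕ}

/-- Agreement prescribes k of the n characters, so the texts lie in a box with k one-element
factors. The product form avoids the exponent n - k. -/
theorem card_charsAgree_mul_le (P : Fin m → Fin σ) (i : ℕ) {k : ℕ} (hk : k ≤ m) :
    (Finset.univ.filter fun T : Fin n → Fin σ => CharsAgree T P i k).card * σ ^ k ≤ σ ^ n := by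
  by_cases hi : i + m ≤ n
  · let S : Fin n → Finset (Fin σ) := fun x =>
      if h : i ≤ (x : ℕ) ∧ (x : ℕ) < i + k then {P ⟨x - i, by omega⟩} else Finset.univ
    have h1 : (Finset.univ.filter fun T : Fin n → Fin σ => CharsAgree T P i k) ⊆
        Fintype.piFinset S := by
      intro T hT
      obtain ⟨_, hT⟩ := (Finset.mem_filter.mp hT).2
      refine Fintype.mem_piFinset.mpr fun x => ?_
      by_cases hx : i ≤ (x : ℕ) ∧ (x : ℕ) < i + k
      · have h2 := hT ⟨x - i, by omega⟩ (by simp only; omega)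
        simp only [S, dif_pos hx, Finset.mem_singleton, ← h2]
        congr 1
        exact Fin.ext (by simp only; omega)
      · simp only [S, dif_neg hx, Finset.mem_univ]
    have h2 : ∏ x : Fin n, (if i ≤ (x : ℕ) ∧ (x : ℕ) < i + k then σ else 1) = σ ^ k := by
      rw [Fin.prod_univ_eq_prod_range (fun x => if i ≤ x ∧ x < i + k then σ else 1) n,
        ← Finset.prod_filter, Finset.prod_const]
      congr 1
      have h3 : (Finset.range n).filter (fun x => i ≤ x ∧ x < i + k) = Finset.Ico i (i + k) := by
        ext x
        simp only [Finset.mem_filter, Finset.mem_range, Finset.mem_Ico]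
        omega
      rw [h3, Nat.card_Ico, Nat.add_sub_cancel_left]
    refine (Nat.mul_le_mul_right _ (Finset.card_le_card h1)).trans (le_of_eq ?_)
    rw [Fintype.card_piFinset, ← h2, ← Finset.prod_mul_distrib]
    trans ∏ _x : Fin n, σ
    · refine Finset.prod_congr rfl fun x _ => ?_
      by_cases hx : i ≤ (x : ℕ) ∧ (x : ℕ) < i + k <;> simp [S, hx]
    · simp
  · have h1 : (Finset.univ.filter fun T : Fin n → Fin σ => CharsAgree T P i k) = ∅ :=
      Finset.filter_eq_empty_iff.mpr fun T _ h => hi h.1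
    rw [h1]
    simp

theorem chunksCompared_le (T : Fin n → Fin σ) (P : Fin m → Fin σ) (i : ℕ) :
    chunksCompared w T P i ≤ chunks w σ m := by
  refine (Finset.card_filter_le _ _).trans ?_
  simp

theorem chunks_le (hA : Admissible w σ n m) : chunks w σ m ≤ m + 1 :=
  Nat.succ_le_succ ((Nat.div_le_self _ _).trans (hA.mul_charBits_div_le m))

/-- Exchanging the sums, index k contributes at most σⁿ / 2ᵏ texts as σ ≥ 2, and the geometric
series sums to at most 2. -/
theorem sum_chunksCompared_le (hA : Admissible w σ n m) (P : Fin m → Fin σ) (i : ℕ) :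
    ∑ T : Fin n → Fin σ, (chunksCompared w T P i : ℝ) ≤ 2 * (σ : ℝ) ^ n := by
  have h1 : ∑ T : Fin n → Fin σ, (chunksCompared w T P i : ℝ) = ∑ k ∈ Finset.range (chunks w σ m),
      ((Finset.univ.filter fun T : Fin n → Fin σ => CharsAgree T P i k).card : ℝ) := by
    simp only [chunksCompared, Finset.card_filter, Nat.cast_sum]
    exact Finset.sum_comm
  have h2 : ∀ k ∈ Finset.range (chunks w σ m),
      ((Finset.univ.filter fun T : Fin n → Fin σ => CharsAgree T P i k).card : ℝ) ≤
        (1 / 2 : ℝ) ^ k * (σ : ℝ) ^ n := by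
    intro k hk
    have hk' : k ≤ m := by have := chunks_le hA; have := Finset.mem_range.mp hk; omega
    have h3 : ((Finset.univ.filter fun T : Fin n → Fin σ => CharsAgree T P i k).card : ℝ) *
        (2 : ℝ) ^ k ≤ (σ : ℝ) ^ n := by
      have h4 := (Nat.mul_le_mul_left _ (Nat.pow_le_pow_left hA.two_le k)).trans
        (card_charsAgree_mul_le (n := n) P i hk')
      exact_mod_cast h4
    rw [one_div, inv_pow, inv_mul_eq_div, le_div_iff₀ (by positivity)]
    exact h3
  rw [h1]
  refine (Finset.sum_le_sum h2).trans ?_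
  rw [← Finset.sum_mul]
  exact mul_le_mul_of_nonneg_right (sum_geometric_two_le _) (by positivity)

/-- Rounding up costs less than 1, and 1 ≤ log₂ σ. -/
theorem charBits_le_logb (hσ : 2 ≤ σ) : (charBits σ : ℝ) ≤ 2 * Real.logb 2 σ := by
  have h1 : 1 ≤ Real.logb 2 σ := by
    rw [Real.le_logb_iff_rpow_le (by norm_num) (by positivity), Real.rpow_one]
    exact_mod_cast hσ
  have h2 : ((charBits σ - 1 : ℕ) : ℝ) ≤ Real.logb 2 σ := by
    rw [Real.le_logb_iff_rpow_le (by norm_num) (by positivity), Real.rpow_natCast]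
    exact_mod_cast (Nat.pow_pred_clog_lt_self (b := 2) (by norm_num) (by omega)).le
  have h3 : (charBits σ : ℝ) ≤ ((charBits σ - 1 : ℕ) : ℝ) + 1 := by
    exact_mod_cast (by omega : charBits σ ≤ charBits σ - 1 + 1)
  linarith

/-- The factor 4 is 2 from rounding log₂ σ up, times 2 from w * (w - 1) ≥ w ^ 2 / 2. -/
theorem chunks_le_logb (hA : Admissible w σ n m) :
    (chunks w σ m : ℝ) ≤ 4 * (m * Real.logb 2 σ / (w : ℝ) ^ 2) + 1 := by
  have hw : (6 : ℝ) ≤ w := by exact_mod_cast hA.six_le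
  have h1 : (chunks w σ m : ℝ) ≤ (m * charBits σ : ℝ) / (w * (w - 1)) + 1 := by
    have h2 : ((m * charBits σ / (w * (w - 1)) : ℕ) : ℝ) ≤
        ((m * charBits σ : ℕ) : ℝ) / ((w * (w - 1) : ℕ) : ℝ) := Nat.cast_div_le
    rw [chunks, Nat.div_div_eq_div_mul]
    push_cast [Nat.cast_sub (show 1 ≤ w by have := hA.six_le; omega)] at h2 ⊢
    linarith
  have h3 : (m * charBits σ : ℝ) / (w * (w - 1)) ≤ (m * (2 * Real.logb 2 σ)) / ((w : ℝ) ^ 2 / 2) := by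
    refine div_le_div₀ ?_ (mul_le_mul_of_nonneg_left (charBits_le_logb hA.two_le) (by positivity))
      (by positivity) (by nlinarith)
    have : 0 ≤ Real.logb 2 σ := Real.logb_nonneg (by norm_num)
      (by exact_mod_cast (by have := hA.two_le; omega : 1 ≤ σ))
    positivity
  have h4 : (m * (2 * Real.logb 2 σ)) / ((w : ℝ) ^ 2 / 2) = 4 * (m * Real.logb 2 σ / (w : ℝ) ^ 2) := by
    field_simp
    ring
  linarith

/-- Running times of `searchProgram` on all instances of the given size, with a bound. -/
theorem exists_time (hA : Admissible w σ n m) : ∃ time : (Fin n → Fin σ) → (Fin m → Fin σ) → ℕ,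
    (∀ T P, RunsIn searchProgram 53 17 w T P (time T P)) ∧ ∀ T P, (time T P : ℝ) ≤
      31 + 28 * m + ∑ k ∈ Finset.range (n + 1), (32 + 15 * (chunksCompared w T P k : ℝ)) := by
  choose time h1 h2 using exists_runsIn hA
  exact ⟨time, h1, fun T P => by exact_mod_cast h2 T P⟩

end BMH

/-! ### The theorem: assembling the three bounds -/

theorem mainTheorem5 :
    ∃ (prog : List UWRAM.Instr) (l pos : ℕ) (C : ℝ), 0 < C ∧
      ∀ (w σ n m : ℕ), 2 ≤ σ → 1 ≤ m → m ≤ n → 16 * (n + m + σ) ≤ 2 ^ w →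
        ∃ time : (Fin n → Fin σ) → (Fin m → Fin σ) → ℕ,
          (∀ T P, BMH.RunsIn prog l pos w T P (time T P)) ∧
          (∀ T P, (time T P : ℝ) ≤ C * (n * ((m * Real.logb 2 σ) / (w : ℝ) ^ 2 + 1))) ∧
          (w ^ 2 ≤ m * BMH.charBits σ → ∀ T P,
            (time T P : ℝ) ≤ C * ((m * n * Real.logb 2 σ) / (w : ℝ) ^ 2 + 1)) ∧
          (∀ P, (𝔼 T, (time T P : ℝ)) ≤ C * n) := by
  -- The constant is 3 * 200: the worst case needs at most 200 * n * (x + 1), and x + 1 ≤ 3 * x for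
  -- a pattern that fills a wide word. The mean needs less.
  refine ⟨BMH.searchProgram, 53, 17, 600, by norm_num, fun w σ n m hσ hm hmn hb => ?_⟩
  have hA : BMH.Admissible w σ n m := ⟨hσ, hm, hmn, hb⟩
  obtain ⟨time, h1, h2⟩ := BMH.exists_time hA
  have hn1 : (1 : ℝ) ≤ n := by exact_mod_cast hm.trans hmn
  have hmn' : (m : ℝ) ≤ n := by exact_mod_cast hmn
  have hw : (6 : ℝ) ≤ w := by exact_mod_cast hA.six_le
  have hlog : 0 ≤ Real.logb 2 σ := Real.logb_nonneg (by norm_num)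
    (by exact_mod_cast (by omega : 1 ≤ σ))
  set x := (m * Real.logb 2 σ) / (w : ℝ) ^ 2 with hx
  have hx0 : 0 ≤ x := by positivity
  have hworst : ∀ T P, (time T P : ℝ) ≤ 200 * (n * (x + 1)) := by
    intro T P
    have h3 : ∑ k ∈ Finset.range (n + 1), (32 + 15 * (BMH.chunksCompared w T P k : ℝ)) ≤
        ∑ _k ∈ Finset.range (n + 1), (32 + 15 * (4 * x + 1)) := by
      refine Finset.sum_le_sum fun k _ => ?_
      have h4 : (BMH.chunksCompared w T P k : ℝ) ≤ BMH.chunks w σ m := by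
        exact_mod_cast BMH.chunksCompared_le T P k
      have h5 := BMH.chunks_le_logb hA
      linarith
    rw [Finset.sum_const, Finset.card_range, nsmul_eq_mul] at h3
    push_cast at h3
    have h6 := h2 T P
    nlinarith [mul_nonneg (sub_nonneg.mpr hn1) hx0]
  refine ⟨time, h1, fun T P => (hworst T P).trans ?_, fun hfill T P => (hworst T P).trans ?_,
    fun P => ?_⟩
  · have : 0 ≤ (n : ℝ) * (x + 1) := by positivity
    linarith
  -- A pattern filling a wide word makes x at least 1/2, so the summand 1 per position is absorbed
  -- by x.
  · have hhalf : 1 ≤ 2 * x := by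
      have h3 : (w : ℝ) ^ 2 ≤ m * BMH.charBits σ := by exact_mod_cast hfill
      have h4 : (m : ℝ) * BMH.charBits σ ≤ m * (2 * Real.logb 2 σ) :=
        mul_le_mul_of_nonneg_left (BMH.charBits_le_logb hσ) (by positivity)
      rw [hx, ← mul_div_assoc, le_div_iff₀ (by positivity)]
      linarith
    have h5 : m * n * Real.logb 2 σ / (w : ℝ) ^ 2 = n * x := by rw [hx]; ring
    rw [h5]
    nlinarith
  · have hσn : (0 : ℝ) < (σ : ℝ) ^ n := by positivity
    have hcard : (Fintype.card (Fin n → Fin σ) : ℝ) = (σ : ℝ) ^ n := by simp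
    rw [Fintype.expect_eq_sum_div_card, hcard, div_le_iff₀ hσn]
    calc ∑ T, (time T P : ℝ)
        ≤ ∑ T : Fin n → Fin σ, (31 + 28 * (m : ℝ) + ∑ k ∈ Finset.range (n + 1),
          (32 + 15 * (BMH.chunksCompared w T P k : ℝ))) := Finset.sum_le_sum fun T _ => h2 T P
      _ = (σ : ℝ) ^ n * (31 + 28 * m + (n + 1) * 32) + 15 * ∑ k ∈ Finset.range (n + 1),
          ∑ T : Fin n → Fin σ, (BMH.chunksCompared w T P k : ℝ) := by
        -- Exchanging texts and positions is what reduces the mean to one fixed position at a time.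
        rw [Finset.sum_comm (s := Finset.range (n + 1))]
        simp only [Finset.sum_add_distrib, Finset.sum_const, Finset.card_range, Finset.card_univ,
          nsmul_eq_mul, hcard, ← Finset.mul_sum]
        push_cast
        ring
      _ ≤ (σ : ℝ) ^ n * (31 + 28 * m + (n + 1) * 32) + 15 * ∑ k ∈ Finset.range (n + 1),
          2 * (σ : ℝ) ^ n := by
        gcongr with k hk
        exact BMH.sum_chunksCompared_le hA P k
      _ ≤ 600 * n * (σ : ℝ) ^ n := by
        rw [Finset.sum_const, Finset.card_range, nsmul_eq_mul]
        push_cast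
        have : 31 + 28 * (m : ℝ) + (n + 1) * 32 + 15 * ((n + 1) * 2) ≤ 600 * n := by linarith
        nlinarith
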